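/- Let $D\ge 2$ be an integer and let $s\in\mathbb R$. Let $\mathcal B_D$ be the Bratteli diagram of the $D\times D$ all-ones matrix, with infinite path space $\partial\mathcal B_D$. A path with $n$ edges is the same as its string of vertices $v_0v_1\cdots v_n$, and has length $n$. Let $(F\mathcal B_D)_\circ=F\mathcal B_D\cup\{\circ\}$ be the set of finite paths together with the empty path $\circ$, of length $|\circ|=-1$. Write $[\gamma]\subseteq\partial\mathcal B_D$ for the cylinder set of infinite paths with initial segment $\gamma$, and $[\circ]=\partial\mathcal B_D$. Let $w=w_D^D$ be the weight $w(\circ)=1$, $w(\gamma)=D^{-|\gamma|-1}$, and let $d_w(x,y)=w(x\wedge y)$ for $x\neq y$, where $x\wedge y$ is the longest common initial segment, and $d_w(x,x)=0$. Let $\mu_D$ be the probability measure on $\partial\mathcal B_D$ with $\mu_D([\gamma])=D^{-(|\gamma|+1)}$. Then $\mu_D$ is the measure given by the Dixmier trace, that is, $\mu_D([\gamma])=\lim_{t\downarrow 1}\sum_{\eta=\gamma\eta'}w(\eta)^t\big/\sum_{\eta}w(\eta)^t$ for all $\gamma\in(F\mathcal B_D)_\circ$, with sums over $\eta\in(F\mathcal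 B_D)_\circ$. A choice function $\tau=(\tau_+,\tau_-)$ assigns to every $\gamma\in(F\mathcal B_D)_\circ$ two points $\tau_\pm(\gamma)\in[\gamma]$ with $d_w(\tau_+(\gamma),\tau_-(\gamma))=w(\gamma)$. The set $E$ of choice functions carries the product probability measure $\mu_D(\tau)$, whose factor at $\gamma$ is the normalised restriction of $\mu_D\times\mu_D$ to the admissible pairs. On $\ell^2((F\mathcal B_D)_\circ)\otimes\mathbb C^2$ let $\pi_\tau(f)=\bigoplus_\gamma\operatorname{diag}(f(\tau_+(\gamma)),f(\tau_-(\gamma)))$ and $\slashed D=\bigoplus_\gamma\frac1{w(\gamma)}\begin{pmatrix}0&1\\1&0\end{pmatrix}$, and let $$Q_s(f,g)=\frac12\int_E\operatorname{Tr}\bigl(|\slashed D|^{-s}[\slashed D,\pi_\tau(f)]^*[\slashed D,\pi_\tau(g)]\bigr)\,d\mu_D(\tau),\qquad \operatorname{Dom}Q_s=\operatorname{span}\{\chi_{[\gamma]}\}.$$ There is a self-adjoint operator $\Delta_s$ on $L^2(\partial\mathcal B_D,\mu_D)$, the Laplace–Beltrami operator, which is the operator associated with the closure of $Q_s$, normalised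 to be non-positive: $\langle f,-\Delta_s g\rangle=Q_s(f,g)$. Put $$\lambda_\circ=-G_s(\circ)^{-1}=-\frac{2D}{D-1},\qquad G_s(\circ)=\frac12\sum_{v\ne v'}\mu_D([v])\mu_D([v']),$$ $$\lambda_\eta=-2-2D^{3-s}\,\frac{1-D^{(3-s)|\eta|}}{1-D^{3-s}}-\frac{2D^{3|\eta|+4}}{(D-1)D^{s(|\eta|+1)}}\qquad(\eta\in F\mathcal B_D),$$ where for $s=3$ the first quotient means its limit $|\eta|$. Let $E_\circ=\operatorname{span}\{\chi_{[v]}-\chi_{[v']}:v\neq v'\in V_0\}$, where $V_0$ is the set of the $D$ vertices of level $0$, and for $\eta\in F\mathcal B_D$ let $E_\eta=\operatorname{span}\{\chi_{[\eta e]}-\chi_{[\eta e']}\}$, where $e\neq e'$ run over the edges by which the path $\eta$ can be continued. Then: 1. The set of eigenvalues of $\Delta_s$ is $\{0\}\cup\{\lambda_\eta:\eta\in(F\mathcal B_D)_\circ\}$. 2. The eigenspace of $0$ consists of the constant functions. 3. For every $\eta\in(F\mathcal B_D)_\circ$, $E_\eta\ne\{0\}$ consists of functions $u$ in the domain of $\Delta_s$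 with $\Delta_su=\lambda_\eta u$. For every $\lambda\neq0$, the space $\ker(\Delta_s-\lambda)$ is the closed linear span of the $E_\eta$ with $\lambda_\eta=\lambda$. 4. The constants and the spaces $E_\eta$, $\eta\in(F\mathcal B_D)_\circ$, are pairwise orthogonal, and their sum is dense in $L^2(\partial\mathcal B_D,\mu_D)$. -/

import Mathlib

open MeasureTheory Filter Topology
open scoped ENNReal MatrixOrder

noncomputable section

namespace CuntzBratteli

/-! ### Paths

In the Bratteli diagram `𝓑_D` of the `D × D` all-ones matrix there is exactly one edge between any
two vertices on consecutive levels, so a path is the same thing as its string of vertices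
`v₀ v₁ v₂ …`. -/

/-- The infinite path space `∂𝓑_D`; an infinite path is given by its string of vertices. -/
abbrev InfPath (D : ℕ) : Type := ℕ → Fin D

/-- Finite paths of `𝓑_D` including the empty path `∘`. The list `[v₀, …, vₙ]` is the path of
length `n` (it has `n` edges) through the vertices `v₀, …, vₙ`; the list `[]` is the empty path `∘`,
of length `-1`. The paths of length `0` are the vertices of level `0`. -/
abbrev FinPath (D : ℕ) : Type := List (Fin D)

/-- The length `|γ|`: the number of edges of `γ`, and `-1` for the empty path. -/
def len {D : ℕ} (γ : FinPath D) : ℤ := (γ.length : ℤ) - 1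

/-- The cylinder set `[γ]` of all infinite paths with initial segment `γ`. -/
def cyl {D : ℕ} (γ : FinPath D) : Set (InfPath D) :=
  {x | ∀ i : Fin γ.length, x i = γ.get i}

theorem measurableSet_cyl {D : ℕ} (γ : FinPath D) : MeasurableSet (cyl γ) := by
  have h : cyl γ = ⋂ i : Fin γ.length, (fun x : InfPath D => x i) ⁻¹' {γ.get i} := by
    ext x; simp [cyl]
  rw [h]
  exact MeasurableSet.iInter fun i => measurable_pi_apply (i : ℕ) (measurableSet_singleton _)

/-- The path `γe` obtained from `γ` by adding the edge `e` with range `s(γ)` and source `v`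
(for `γ = ∘` it is the level-`0` vertex `v`). -/
def extend {D : ℕ} (γ : FinPath D) (v : Fin D) : FinPath D := γ ++ [v]

/-- The longest common initial segment `x ∧ y` of two distinct infinite paths. -/
def meet {D : ℕ} (x y : InfPath D) : FinPath D :=
  List.ofFn fun i : Fin (PiNat.firstDiff (E := fun _ => Fin D) x y) => x i

/-! ### Weight, ultrametric and measure -/

/-- The weight `w_D^lam`: `w(∘) = 1` and `w(γ) = lam^{-n} / D` for a path of length `n ≥ 0`. -/
def weight (D : ℕ) (lam : ℝ) (γ : FinPath D) : ℝ :=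
  if γ = [] then 1 else lam ^ (-len γ) * (1 / (D : ℝ))

/-- The weight `w_D^D`. -/
abbrev wD {D : ℕ} (γ : FinPath D) : ℝ := weight D (D : ℝ) γ

open Classical in
/-- The ultrametric `d_w` of the weight `w_D^D`. -/
def ultraDist {D : ℕ} (x y : InfPath D) : ℝ :=
  if x = y then 0 else wD (meet x y)

/-- The measure `μ_D` on `∂𝓑_D`: the probability measure with `μ_D([γ]) = D^{-(|γ|+1)}`, built as
the infinite product of the uniform measures on the `D` vertices. -/
def muD (D : ℕ) : Measure (InfPath D) :=
  Measure.infinitePi fun _ : ℕ => ProbabilityTheory.uniformOn (Set.univ : Set (Fin D))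

instance (D : ℕ) [NeZero D] : IsProbabilityMeasure (muD D) := by
  unfold muD; infer_instance

/-- `μ_D` gives the cylinder sets the masses determined by the Dixmier trace of the spectral triple
of the weight `w_D^D`, whose zeta function has abscissa of convergence `ln D / ln D = 1`:
`μ_D([γ]) = lim_{t ↓ 1} (∑_{η = γη'} w(η)^t) / (∑_η w(η)^t)`. -/
def IsDixmierMeasure (D : ℕ) (μ : Measure (InfPath D)) : Prop :=
  ∀ γ : FinPath D,
    Tendsto
      (fun t : ℝ =>
        (∑' η : {η : FinPath D // γ <+: η}, wD η.1 ^ t) / (∑' η : FinPath D, wD η ^ t))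
      (𝓝[>] (1 : ℝ)) (𝓝 (μ.real (cyl γ)))

/-! ### The spectral triple

All operators on `ℋ = ℓ²((F𝓑_D)_∘) ⊗ ℂ²` below are direct sums of `2 × 2` blocks indexed by the
finite paths; they are given by their families of blocks. -/

/-- The pairs that a choice function may take at `γ`. -/
def choicePairs {D : ℕ} (γ : FinPath D) : Set (InfPath D × InfPath D) :=
  {p | p.1 ∈ cyl γ ∧ p.2 ∈ cyl γ ∧ ultraDist p.1 p.2 = wD γ}

/-- The set `E` of choice functions `τ = (τ₊, τ₋)`. -/
def choiceFunctions (D : ℕ) : Set (FinPath D → InfPath D × InfPath D) :=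
  {τ | ∀ γ, τ γ ∈ choicePairs γ}

/-- The measure `μ_D(τ)` induced by `μ_D` on the set of choice functions: the product over all
finite paths `γ` of the normalised restrictions of `μ_D × μ_D` to the choice pairs at `γ`. -/
def choiceMeasure (D : ℕ) : Measure (FinPath D → InfPath D × InfPath D) :=
  Measure.infinitePi fun γ => ProbabilityTheory.cond ((muD D).prod (muD D)) (choicePairs γ)

/-- Blocks of the representation `π_τ(f)`. -/
def rep {D : ℕ} (τ : FinPath D → InfPath D × InfPath D) (f : InfPath D → ℂ) (γ : FinPath D) :
    Matrix (Fin 2) (Fin 2) ℂ :=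
  !![f (τ γ).1, 0; 0, f (τ γ).2]

/-- Blocks of the Dirac operator. -/
def dirac {D : ℕ} (γ : FinPath D) : Matrix (Fin 2) (Fin 2) ℂ :=
  ((1 / wD γ : ℝ) : ℂ) • !![0, 1; 1, 0]

/-- Blocks of the commutator of the Dirac operator with `π_τ(f)`. -/
def diracComm {D : ℕ} (τ : FinPath D → InfPath D × InfPath D) (f : InfPath D → ℂ)
    (γ : FinPath D) : Matrix (Fin 2) (Fin 2) ℂ :=
  dirac γ * rep τ f γ - rep τ f γ * dirac γ

/-- The trace of a direct sum of `2 × 2` blocks. -/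
def blockTrace {D : ℕ} (T : FinPath D → Matrix (Fin 2) (Fin 2) ℂ) : ℂ :=
  ∑' γ, (T γ).trace

/-- The form `Q_s(f, g) = ½ ∫_E Tr(|𝐃|^{-s} [𝐃, π_τ(f)]^* [𝐃, π_τ(g)]) dμ_D(τ)`,
where `𝐃` is the Dirac operator. -/
def formQ (D : ℕ) (s : ℝ) (f g : InfPath D → ℂ) : ℂ :=
  (1 / 2 : ℂ) * ∫ τ in choiceFunctions D,
    blockTrace (fun γ => CFC.abs (dirac γ) ^ (-s) * star (diracComm τ f γ) * diracComm τ g γ)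
      ∂(choiceMeasure D)

/-- The characteristic function of the cylinder set `[γ]`. -/
def chi {D : ℕ} (γ : FinPath D) : InfPath D → ℂ := (cyl γ).indicator 1

/-- `Dom Q_s = span {χ_[γ]}`. -/
def domQ (D : ℕ) : Submodule ℂ (InfPath D → ℂ) := Submodule.span ℂ (Set.range chi)

/-! ### The Laplace–Beltrami operator -/

/-- The Hilbert space `L²(∂𝓑_D, μ_D)`. -/
abbrev L2 (D : ℕ) : Type := Lp ℂ 2 (muD D)

/-- The graph of the operator of the closure of the form `Q_s`, with the sign that makes the
operator non-positive. The function `g` lies in the domain of the closure of `Q_s` when it is an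
`L²`-limit of a sequence `φ` in `Dom Q_s` that is Cauchy for `Q_s`, and the closed form at `(f, g)`
is then the limit of `Q_s(f, φ n)`. The pair `(g, h)` lies in the graph when in addition
`Q_s(f, g) = ⟨f, -h⟩` for all `f` in the form core `Dom Q_s`. -/
def LaplaceRel (D : ℕ) (s : ℝ) (g h : L2 D) : Prop :=
  ∃ φ : ℕ → InfPath D → ℂ,
    (∀ n, φ n ∈ domQ D) ∧
    Tendsto (fun n => eLpNorm (φ n - ⇑g) 2 (muD D)) atTop (𝓝 0) ∧
    Tendsto (fun p : ℕ × ℕ => formQ D s (φ p.1 - φ p.2) (φ p.1 - φ p.2)) atTop (𝓝 0) ∧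
    ∀ f ∈ domQ D,
      Tendsto (fun n => formQ D s f (φ n)) atTop
        (𝓝 (-∫ x, (starRingEnd ℂ) (f x) * h x ∂(muD D)))

/-- `Δ` is the Laplace–Beltrami operator `Δ_s`. An operator is determined by its graph, so there is
at most one such `Δ`. -/
def IsLaplaceBeltrami (D : ℕ) (s : ℝ) (Δ : L2 D →ₗ.[ℂ] L2 D) : Prop :=
  ∀ g h : L2 D, (g, h) ∈ Δ.graph ↔ LaplaceRel D s g h

/-- The space `ker (Δ - c)` of all `u ∈ dom Δ` with `Δ u = c u`. -/
def eigenspaceOf {D : ℕ} (Δ : L2 D →ₗ.[ℂ] L2 D) (c : ℂ) : Submodule ℂ (L2 D) :=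
  Δ.graph.comap (LinearMap.prod LinearMap.id (c • LinearMap.id))

/-! ### Eigenvalues and eigenspaces -/

/-- The class of `χ_[γ]` in `L²(∂𝓑_D, μ_D)`. -/
def chiL2 {D : ℕ} [NeZero D] (γ : FinPath D) : L2 D :=
  indicatorConstLp 2 (measurableSet_cyl γ) (measure_ne_top (muD D) _) (1 : ℂ)

/-- The constant functions. -/
def constSpace (D : ℕ) [NeZero D] : Submodule ℂ (L2 D) :=
  Submodule.span ℂ {indicatorConstLp 2 MeasurableSet.univ (measure_ne_top (muD D) _) (1 : ℂ)}

/-- `E_η = span {χ_[ηe] - χ_[ηe'] : e ≠ e', r(e) = r(e') = s(η)}`; for `η = ∘` it is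
`span {χ_[v] - χ_[v'] : v ≠ v' ∈ V₀}`. -/
def pathEigenspace {D : ℕ} [NeZero D] (η : FinPath D) : Submodule ℂ (L2 D) :=
  Submodule.span ℂ
    {u | ∃ v v' : Fin D, v ≠ v' ∧ u = chiL2 (extend η v) - chiL2 (extend η v')}

/-- `G_s(η) = ½ w(η)^{2-s} ∑_{e ≠ e'} μ_D[ηe] μ_D[ηe']`. -/
def constG (D : ℕ) (s : ℝ) (η : FinPath D) : ℝ :=
  1 / 2 * wD η ^ (2 - s) *
    ∑ v : Fin D, ∑ v' ∈ Finset.univ.erase v,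
      (muD D).real (cyl (extend η v)) * (muD D).real (cyl (extend η v'))

/-- The quotient `(1 - D^{(3-s)n}) / (1 - D^{3-s})`, which for `s = 3` means its limit `n`. -/
def geomQuot (D : ℕ) (s : ℝ) (n : ℕ) : ℝ :=
  if s = 3 then (n : ℝ)
  else (1 - (D : ℝ) ^ ((3 - s) * (n : ℝ))) / (1 - (D : ℝ) ^ (3 - s))

/-- The eigenvalue `λ_η`. A path `v :: γ` has length `γ.length`. -/
def pathEigenvalue (D : ℕ) (s : ℝ) : FinPath D → ℝ
  | [] => -(2 * (D : ℝ) / ((D : ℝ) - 1))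
  | _ :: γ =>
      -2 - 2 * (D : ℝ) ^ (3 - s) * geomQuot D s γ.length
        - 2 * (D : ℝ) ^ (3 * γ.length + 4) /
            (((D : ℝ) - 1) * (D : ℝ) ^ (s * ((γ.length : ℝ) + 1)))

/-- The constants together with all the spaces `E_η`. -/
def decomposition (D : ℕ) [NeZero D] : Option (FinPath D) → Submodule ℂ (L2 D)
  | none => constSpace D
  | some η => pathEigenspace η

end CuntzBratteli

end

/-! The form is diagonal in the decomposition of `L²` into constants and the spaces `E_η`. Take `f =
χ_[ηv] - χ_[ηw]`. The block of the form at `γ` only sees differences of `f` along pairs that branch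
immediately after `γ`, and these vanish unless `γ` is a prefix of `η`. At a proper prefix, `f` has
mean zero on `[γ]` and on each child of `γ`, so the block is `2 w(γ)⁻¹ ⟨f, g⟩`. At `γ = η`, `f` is
constant on each child, and the factor becomes `2 w(η)⁻¹ (1 - 1/D)⁻¹`. Weighting the blocks by
`w(γ)^(s-2)` turns the sum over prefixes into a geometric sum with ratio `D^(3-s)`, which is `-λ_η`.
Hence `Q_s(f, g) = -λ_η ⟨f, g⟩` for every square integrable `g` (`formQ_chiDiff`).

Averaging over children writes `χ_[γv]` through `χ_[γ]` and elements of `E_γ`, so `Dom Q_s` is the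
algebraic span of the constants and the `E_η`; since cylinders generate the σ-algebra, this span is
dense (`decomposition_total`).

The rest is Hilbert space theory. For an orthogonal total family `V i` and real scalars `l i`, the
maximal diagonal operator is self-adjoint, is the closure of its restriction to the algebraic span,
and has closed spans of the `V i` as eigenspaces. `laplaceRel_iff` identifies its graph with that of
the operator of the closed form. -/

/-! ### Diagonal operators -/

section Diagonal

open scoped InnerProductSpace

variable {ι H : Type*} [NormedAddCommGroup H] [InnerProductSpace ℂ H]

/-- The graph of the maximal operator acting as the scalar `l i` on `V i`. -/
def diagGraph (V : ι → Submodule ℂ H) (l : ι → ℝ) : Submodule ℂ (H × H) where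
  carrier := {p | ∀ i, ∀ v ∈ V i, ⟪v, p.2⟫_ℂ = (l i : ℂ) * ⟪v, p.1⟫_ℂ}
  add_mem' {p q} hp hq i v hv := by
    simp [hp i v hv, hq i v hv, mul_add]
  zero_mem' i v _ := by simp
  smul_mem' c p hp i v hv := by
    simp only [Prod.smul_fst, Prod.smul_snd, inner_smul_right, hp i v hv]
    ring

/-- The graph of the minimal operator acting as the scalar `l i` on `V i`. -/
def diagCore (V : ι → Submodule ℂ H) (l : ι → ℝ) : Submodule ℂ (H × H) :=
  Submodule.span ℂ {p | ∃ i, ∃ v ∈ V i, p = (v, (l i : ℂ) • v)}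

variable {V : ι → Submodule ℂ H} {l : ι → ℝ}

theorem mem_diagGraph {p : H × H} :
    p ∈ diagGraph V l ↔ ∀ i, ∀ v ∈ V i, ⟪v, p.2⟫_ℂ = (l i : ℂ) * ⟪v, p.1⟫_ℂ := Iff.rfl

theorem diagCore_of_mem {i : ι} {v : H} (hv : v ∈ V i) : (v, (l i : ℂ) • v) ∈ diagCore V l :=
  Submodule.subset_span ⟨i, v, hv, rfl⟩

theorem diagGraph_of_mem (hO : ∀ i j, i ≠ j → ∀ u ∈ V i, ∀ v ∈ V j, ⟪u, v⟫_ℂ = 0)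
    {i : ι} {v : H} (hv : v ∈ V i) : (v, (l i : ℂ) • v) ∈ diagGraph V l := by
  intro j u hu
  by_cases h : j = i
  · subst h; simp
  · simp [hO j i h u hu v hv]

theorem diagCore_le (hO : ∀ i j, i ≠ j → ∀ u ∈ V i, ∀ v ∈ V j, ⟪u, v⟫_ℂ = 0) :
    diagCore V l ≤ diagGraph V l := by
  refine Submodule.span_le.2 ?_
  rintro _ ⟨i, v, hv, rfl⟩
  exact diagGraph_of_mem hO hv

theorem diagCore_symm {p q : H × H} (hp : p ∈ diagCore V l) (hq : q ∈ diagGraph V l) :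
    ⟪p.2, q.1⟫_ℂ = ⟪p.1, q.2⟫_ℂ := by
  induction hp using Submodule.span_induction with
  | mem p h =>
    obtain ⟨i, v, hv, rfl⟩ := h
    simp [hq i v hv]
  | zero => simp
  | add p p' _ _ h h' => simp [h, h']
  | smul c p _ h => simp [h]

theorem isClosed_diagGraph : IsClosed (diagGraph V l : Set (H × H)) := by
  have : (diagGraph V l : Set (H × H)) =
      ⋂ i, ⋂ v ∈ V i, {p : H × H | ⟪v, p.2⟫_ℂ = (l i : ℂ) * ⟪v, p.1⟫_ℂ} := by
    ext p; simp [mem_diagGraph]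
  rw [this]
  exact isClosed_iInter fun i => isClosed_iInter fun v => isClosed_iInter fun _ =>
    isClosed_eq (by fun_prop) (by fun_prop)

variable [CompleteSpace H]

/-- In the Hilbert space structure of `H × H`, project a point of the maximal graph onto the closure
of the core. The remainder `z` lies in the maximal graph and is orthogonal to every `(v, l v)`, so
`(1 + l²) ⟪v, z.1⟫ = 0`; totality then gives `z = 0`. -/
theorem diagGraph_le_closure (hO : ∀ i j, i ≠ j → ∀ u ∈ V i, ∀ v ∈ V j, ⟪u, v⟫_ℂ = 0)
    (hV : ∀ x : H, (∀ i, ∀ v ∈ V i, ⟪v, x⟫_ℂ = 0) → x = 0) {p : H × H}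
    (hp : p ∈ diagGraph V l) : p ∈ closure (diagCore V l : Set (H × H)) := by
  let e := WithLp.prodContinuousLinearEquiv 2 ℂ H H
  let K : Submodule ℂ (WithLp 2 (H × H)) := (diagCore V l).comap e.toLinearEquiv.toLinearMap
  obtain ⟨y, hy, z, hz, hyz⟩ :=
    K.topologicalClosure.exists_add_mem_mem_orthogonal (e.symm p)
  have hye : e y ∈ closure (diagCore V l : Set (H × H)) := by
    have : Set.MapsTo e (K : Set _) (diagCore V l : Set (H × H)) := fun x hx => hx
    exact this.closure e.continuous hy
  have hyG : e y ∈ diagGraph V l :=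
    closure_minimal (diagCore_le hO) isClosed_diagGraph hye
  have hpe : p = e y + e z := by
    rw [← map_add, ← hyz]; simp
  have hzG : e z ∈ diagGraph V l := by
    have : e z = p - e y := by rw [hpe]; abel
    rw [this]; exact sub_mem hp hyG
  have h1 : ∀ i, ∀ v ∈ V i, ⟪v, (e z).1⟫_ℂ = 0 := by
    intro i v hv
    have hm : e.symm (v, (l i : ℂ) • v) ∈ K.topologicalClosure :=
      K.le_topologicalClosure (by
        change e (e.symm _) ∈ diagCore V l
        rw [e.apply_symm_apply]; exact diagCore_of_mem hv)
    have h0 := (Submodule.mem_orthogonal _ _).1 hz _ hm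
    rw [WithLp.prod_inner_apply] at h0
    change ⟪v, (e z).1⟫_ℂ + ⟪(l i : ℂ) • v, (e z).2⟫_ℂ = 0 at h0
    rw [inner_smul_left, hzG i v hv, Complex.conj_ofReal] at h0
    have h2 : (1 + (l i : ℂ) * l i) * ⟪v, (e z).1⟫_ℂ = 0 := by linear_combination h0
    refine (mul_eq_zero.1 h2).resolve_left ?_
    have : (0 : ℝ) < 1 + l i * l i := by nlinarith [mul_self_nonneg (l i)]
    exact_mod_cast this.ne'
  have e1 : (e z).1 = 0 := hV _ h1
  have e2 : (e z).2 = 0 := hV _ fun i v hv => by rw [hzG i v hv, h1 i v hv, mul_zero]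
  have : p = e y := by rw [hpe, Prod.ext (x := e z) (y := 0) e1 e2, add_zero]
  rw [this]; exact hye

theorem diagGraph_symm (hO : ∀ i j, i ≠ j → ∀ u ∈ V i, ∀ v ∈ V j, ⟪u, v⟫_ℂ = 0)
    (hV : ∀ x : H, (∀ i, ∀ v ∈ V i, ⟪v, x⟫_ℂ = 0) → x = 0) {p q : H × H}
    (hp : p ∈ diagGraph V l) (hq : q ∈ diagGraph V l) :
    ⟪p.2, q.1⟫_ℂ = ⟪p.1, q.2⟫_ℂ := by
  have hc : IsClosed {p : H × H | ⟪p.2, q.1⟫_ℂ = ⟪p.1, q.2⟫_ℂ} :=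
    isClosed_eq (by fun_prop) (by fun_prop)
  exact closure_minimal (fun p hp => diagCore_symm hp hq) hc (diagGraph_le_closure hO hV hp)

/-- The self-adjoint operator acting as the scalar `l i` on `V i`. -/
noncomputable def diagOp (V : ι → Submodule ℂ H) (l : ι → ℝ) : H →ₗ.[ℂ] H :=
  (diagGraph V l).toLinearPMap

omit [CompleteSpace H] in
theorem diagOp_graph (hV : ∀ x : H, (∀ i, ∀ v ∈ V i, ⟪v, x⟫_ℂ = 0) → x = 0) :
    (diagOp V l).graph = diagGraph V l := by
  refine Submodule.toLinearPMap_graph_eq _ fun x hx hx0 => hV _ fun i v hv => ?_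
  rw [hx i v hv, hx0, inner_zero_right, mul_zero]

theorem diagOp_dense_domain (hO : ∀ i j, i ≠ j → ∀ u ∈ V i, ∀ v ∈ V j, ⟪u, v⟫_ℂ = 0)
    (hV : ∀ x : H, (∀ i, ∀ v ∈ V i, ⟪v, x⟫_ℂ = 0) → x = 0) :
    Dense ((diagOp V l).domain : Set H) := by
  rw [Submodule.dense_iff_topologicalClosure_eq_top, Submodule.topologicalClosure_eq_top_iff,
    Submodule.eq_bot_iff]
  intro x hx
  refine hV x fun i v hv => (Submodule.mem_orthogonal _ _).1 hx v ?_
  exact ⟨(v, (l i : ℂ) • v), diagGraph_of_mem hO hv, rfl⟩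

/-- Testing an adjoint pair against the eigenvectors `(v, l v)` alone already forces it into the
maximal graph; the converse is the symmetry of that graph. -/
theorem diagOp_isSelfAdjoint (hO : ∀ i j, i ≠ j → ∀ u ∈ V i, ∀ v ∈ V j, ⟪u, v⟫_ℂ = 0)
    (hV : ∀ x : H, (∀ i, ∀ v ∈ V i, ⟪v, x⟫_ℂ = 0) → x = 0) :
    IsSelfAdjoint (diagOp V l) := by
  rw [LinearPMap.isSelfAdjoint_def]
  refine LinearPMap.eq_of_eq_graph ?_
  rw [LinearPMap.adjoint_graph_eq_graph_adjoint (diagOp_dense_domain hO hV), diagOp_graph hV]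
  ext p
  rw [Submodule.mem_adjoint_iff]
  constructor
  · intro h i v hv
    have := h v _ (diagGraph_of_mem hO hv)
    rw [inner_smul_left, Complex.conj_ofReal] at this
    linear_combination -this
  · intro hp a b hab
    exact sub_eq_zero.2 (diagGraph_symm hO hV hab hp)

theorem diagGraph_eigenspace (hO : ∀ i j, i ≠ j → ∀ u ∈ V i, ∀ v ∈ V j, ⟪u, v⟫_ℂ = 0)
    (hV : ∀ x : H, (∀ i, ∀ v ∈ V i, ⟪v, x⟫_ℂ = 0) → x = 0) (c : ℂ) :
    (diagGraph V l).comap (LinearMap.prod LinearMap.id (c • LinearMap.id)) =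
      (⨆ i : {i // (l i : ℂ) = c}, V i.1).topologicalClosure := by
  have hle : (⨆ i : {i // (l i : ℂ) = c}, V i.1).topologicalClosure ≤
      (diagGraph V l).comap (LinearMap.prod LinearMap.id (c • LinearMap.id)) := by
    refine Submodule.topologicalClosure_minimal _ (iSup_le ?_) ?_
    · rintro ⟨i, rfl⟩ v hv
      exact diagGraph_of_mem hO hv
    · exact isClosed_diagGraph.preimage
        (f := fun x : H => (x, c • x)) (by fun_prop)
  refine le_antisymm (fun x hx => ?_) hle
  obtain ⟨y, hy, z, hz, rfl⟩ := (⨆ i : {i // (l i : ℂ) = c},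
    V i.1).topologicalClosure.exists_add_mem_mem_orthogonal x
  have hzG := sub_mem hx (hle hy)
  rw [add_sub_cancel_left] at hzG
  -- On a `V i` with `l i = c`, `z` is orthogonal by construction; on the others the eigenvalue
  -- equation gives `(c - l i) ⟪v, z⟫ = 0`.
  have : z = 0 := by
    refine hV z fun i v hv => ?_
    by_cases h : (l i : ℂ) = c
    · exact (Submodule.mem_orthogonal _ _).1 hz v (Submodule.le_topologicalClosure _
        (Submodule.mem_iSup_of_mem (p := fun i : {i // (l i : ℂ) = c} => V i.1) ⟨i, h⟩ hv))
    · have h1 : ⟪v, c • z⟫_ℂ = (l i : ℂ) * ⟪v, z⟫_ℂ := hzG i v hv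
      rw [inner_smul_right] at h1
      have h2 : (c - l i) * ⟪v, z⟫_ℂ = 0 := by linear_combination h1
      exact (mul_eq_zero.1 h2).resolve_left (sub_ne_zero.2 (Ne.symm h))
  rw [this, add_zero]; exact hy

end Diagonal

noncomputable section

namespace CuntzBratteli

variable {D : ℕ}

/-! ### Weights and the trace of one block -/

theorem wD_eq [NeZero D] (γ : FinPath D) : wD γ = ((D : ℝ) ^ γ.length)⁻¹ := by
  have hD : (D : ℝ) ≠ 0 := NeZero.ne _
  by_cases h : γ = []
  · simp [wD, weight, h]
  · simp only [weight, h, if_false, len, neg_sub]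
    rw [zpow_sub₀ hD]
    simp
    field_simp

theorem wD_pos [NeZero D] (γ : FinPath D) : 0 < wD γ := by
  have hD : (0 : ℝ) < D := Nat.cast_pos.2 (NeZero.pos D)
  rw [wD_eq]; positivity

/-- The block is the positive scalar `w(γ)⁻¹` times a unitary, so its absolute value is that scalar
and the functional calculus is scalar exponentiation. -/
theorem abs_dirac_rpow [NeZero D] (γ : FinPath D) (s : ℝ) :
    CFC.abs (dirac γ) ^ (-s) = ((wD γ ^ s : ℝ) : ℂ) • (1 : Matrix (Fin 2) (Fin 2) ℂ) := by
  have hw := wD_pos γ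
  have hU : (!![0, 1; 1, 0] : Matrix (Fin 2) (Fin 2) ℂ) ∈ unitary (Matrix (Fin 2) (Fin 2) ℂ) := by
    rw [Unitary.mem_iff]
    constructor <;> ext i j <;> fin_cases i <;> fin_cases j <;>
      simp [Matrix.star_eq_conjTranspose, Matrix.mul_apply, Fin.sum_univ_two]
  have h1 : CFC.abs (dirac γ) =
      algebraMap NNReal (Matrix (Fin 2) (Fin 2) ℂ) (Real.toNNReal (wD γ)⁻¹) := by
    rw [dirac, CFC.abs_smul, CFC.abs_of_mem_unitary hU]
    rw [Algebra.algebraMap_eq_smul_one (R := NNReal), NNReal.smul_def,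
      Real.coe_toNNReal _ (inv_nonneg.2 hw.le)]
    simp [abs_of_pos hw]
  rw [h1, CFC.rpow_algebraMap, Algebra.algebraMap_eq_smul_one, NNReal.smul_def]
  rw [NNReal.coe_rpow, Real.coe_toNNReal _ (inv_nonneg.2 hw.le), Real.inv_rpow hw.le, Real.rpow_neg hw.le, inv_inv]
  ext i j; simp

theorem trace_block [NeZero D] (s : ℝ) (τ : FinPath D → InfPath D × InfPath D)
    (f g : InfPath D → ℂ) (γ : FinPath D) :
    (CFC.abs (dirac γ) ^ (-s) * star (diracComm τ f γ) * diracComm τ g γ).trace =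
      2 * ((wD γ ^ (s - 2) : ℝ) : ℂ) *
        ((starRingEnd ℂ) (f (τ γ).1 - f (τ γ).2) * (g (τ γ).1 - g (τ γ).2)) := by
  have hw := wD_pos γ
  rw [abs_dirac_rpow, Real.rpow_sub hw, Real.rpow_two]
  have hw' : ((wD γ : ℝ) : ℂ) ≠ 0 := by exact_mod_cast hw.ne'
  simp only [diracComm, dirac, rep, Matrix.trace, Matrix.star_eq_conjTranspose, Fin.sum_univ_two,
    Matrix.diag, Matrix.mul_apply, Matrix.smul_apply, Matrix.conjTranspose_apply,
    Matrix.sub_apply]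
  simp
  field_simp
  ring

/-! ### Cylinder sets -/

/-- Membership becomes an equation of lists, from which prefix relations between paths can be read
off. -/
theorem mem_cyl_iff {γ : FinPath D} {x : InfPath D} :
    x ∈ cyl γ ↔ (List.range γ.length).map x = γ := by
  constructor
  · intro h
    refine List.ext_getElem (by simp) fun i h1 h2 => ?_
    simpa using h ⟨i, h2⟩
  · intro h i
    have h2 : i.1 < ((List.range γ.length).map x).length := by simp
    have := List.getElem_of_eq h h2
    simpa using this

theorem cyl_nil : cyl ([] : FinPath D) = Set.univ := by
  ext x; simp [mem_cyl_iff]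

theorem mem_cyl_extend {γ : FinPath D} {v : Fin D} {x : InfPath D} :
    x ∈ cyl (extend γ v) ↔ x ∈ cyl γ ∧ x γ.length = v := by
  simp [mem_cyl_iff, extend, List.range_succ]

theorem length_extend (γ : FinPath D) (v : Fin D) : (extend γ v).length = γ.length + 1 := by
  simp [extend]

theorem wD_extend [NeZero D] (γ : FinPath D) (v : Fin D) :
    wD (extend γ v) = wD γ / D := by
  rw [wD_eq, wD_eq, length_extend, pow_succ, mul_inv, div_eq_mul_inv]

theorem prefix_of_mem_cyl {γ δ : FinPath D} {x : InfPath D} (hγ : x ∈ cyl γ) (hδ : x ∈ cyl δ)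
    (h : γ.length ≤ δ.length) : γ <+: δ := by
  rw [mem_cyl_iff] at hγ hδ
  rw [← hγ, ← hδ]
  obtain ⟨k, hk⟩ := Nat.exists_eq_add_of_le h
  rw [hk, List.range_add, List.map_append]
  exact List.prefix_append _ _

theorem cyl_subset {γ δ : FinPath D} (h : γ <+: δ) : cyl δ ⊆ cyl γ := by
  obtain ⟨t, rfl⟩ := h
  induction t using List.reverseRecOn with
  | nil => simp
  | append_singleton t v ih =>
    rw [← List.append_assoc]
    exact fun x hx => ih (mem_cyl_extend.1 hx).1

theorem cyl_disjoint {γ δ : FinPath D} (hl : γ.length ≤ δ.length) (h : ¬ γ <+: δ) :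
    Disjoint (cyl γ) (cyl δ) :=
  Set.disjoint_left.2 fun _ hγ hδ => h (prefix_of_mem_cyl hγ hδ hl)

theorem pairwise_disjoint_extend (γ : FinPath D) :
    Pairwise (Function.onFun Disjoint fun v => cyl (extend γ v)) := fun _ _ hvw =>
  Set.disjoint_left.2 fun _ hv hw =>
    hvw ((mem_cyl_extend.1 hv).2.symm.trans (mem_cyl_extend.1 hw).2)

theorem iUnion_extend (γ : FinPath D) : ⋃ v, cyl (extend γ v) = cyl γ := by
  ext x; simp [mem_cyl_extend]

/-- For `D ≥ 2` the weight determines the length, so distance `w(γ)` means that the two paths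
separate exactly at the first vertex after `γ`. -/
theorem mem_choicePairs (hD : 2 ≤ D) {γ : FinPath D} {p : InfPath D × InfPath D} :
    p ∈ choicePairs γ ↔ p.1 ∈ cyl γ ∧ p.2 ∈ cyl γ ∧ p.1 γ.length ≠ p.2 γ.length := by
  have : NeZero D := ⟨by omega⟩
  obtain ⟨x, y⟩ := p
  have hD1 : (1 : ℝ) < D := by exact_mod_cast hD
  constructor
  · rintro ⟨hx, hy, h⟩
    refine ⟨hx, hy, ?_⟩
    have hne : x ≠ y := by
      rintro rfl
      simp only [ultraDist, if_true] at h
      exact (wD_pos γ).ne h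
    simp only [ultraDist, hne, if_false] at h
    rw [wD_eq, wD_eq, inv_inj, meet, List.length_ofFn] at h
    have := pow_right_injective₀ (by positivity) hD1.ne' h
    rw [← this]
    exact PiNat.apply_firstDiff_ne hne
  · rintro ⟨hx, hy, h⟩
    refine ⟨hx, hy, ?_⟩
    have hne : x ≠ y := fun e => h (by simp [e])
    have h1 : PiNat.firstDiff x y ≤ γ.length := by
      by_contra hlt
      exact h (PiNat.apply_eq_of_lt_firstDiff (not_le.1 hlt))
    have h2 : γ.length ≤ PiNat.firstDiff x y := by
      by_contra hlt
      exact PiNat.apply_firstDiff_ne hne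
        ((hx ⟨_, not_le.1 hlt⟩).trans (hy ⟨_, not_le.1 hlt⟩).symm)
    simp only [ultraDist, hne, if_false]
    rw [wD_eq, wD_eq, meet, List.length_ofFn, le_antisymm h1 h2]

theorem choicePairs_eq (hD : 2 ≤ D) (γ : FinPath D) :
    choicePairs γ = (cyl γ ×ˢ cyl γ) \ ⋃ v, cyl (extend γ v) ×ˢ cyl (extend γ v) := by
  ext p
  rw [mem_choicePairs hD]
  simp only [Set.mem_sdiff, Set.mem_prod, Set.mem_iUnion, mem_cyl_extend]
  constructor
  · rintro ⟨h1, h2, h3⟩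
    exact ⟨⟨h1, h2⟩, fun ⟨v, hv, hw⟩ => h3 (hv.2.trans hw.2.symm)⟩
  · rintro ⟨⟨h1, h2⟩, h3⟩
    exact ⟨h1, h2, fun h => h3 ⟨_, ⟨h1, rfl⟩, ⟨h2, h.symm⟩⟩⟩

theorem measurableSet_choicePairs (hD : 2 ≤ D) (γ : FinPath D) :
    MeasurableSet (choicePairs γ) := by
  rw [choicePairs_eq hD]
  exact ((measurableSet_cyl γ).prod (measurableSet_cyl γ)).diff
    (MeasurableSet.iUnion fun v => (measurableSet_cyl _).prod (measurableSet_cyl _))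

/-! ### The measure -/

theorem muD_cyl [NeZero D] (γ : FinPath D) : (muD D).real (cyl γ) = wD γ := by
  -- The default `0` is never read, since only indices below the length occur.
  have h : cyl γ = Set.pi (Finset.range γ.length : Set ℕ) (fun i => {γ.getD i 0}) := by
    ext x
    simp only [cyl, Set.mem_ofPred_eq, Set.mem_pi, Finset.coe_range, Set.mem_Iio,
      Set.mem_singleton_iff]
    constructor
    · intro h i hi; rw [h ⟨i, hi⟩]; simp [hi]
    · intro h i; rw [h i i.2]; simp
  rw [measureReal_def, h, muD, Measure.infinitePi_pi _ fun _ _ => measurableSet_singleton _]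
  simp [ProbabilityTheory.uniformOn_univ, wD_eq, ENNReal.toReal_inv]

/-- The hypothesis says that `δ` does not properly extend `γ`; then `[γ]` is contained in `[δ]` or
disjoint from it. -/
theorem chi_eq_of_mem {γ δ : FinPath D} (h : γ <+: δ → δ.length ≤ γ.length) {x y : InfPath D}
    (hx : x ∈ cyl γ) (hy : y ∈ cyl γ) : chi δ x = chi δ y := by
  have key : ∀ x y : InfPath D, x ∈ cyl γ → y ∈ cyl γ → x ∈ cyl δ → y ∈ cyl δ := by
    intro x y hx hy hxδ
    have hl : δ.length ≤ γ.length := by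
      by_contra hlt
      exact hlt (h (prefix_of_mem_cyl hx hxδ (by omega)))
    exact cyl_subset (prefix_of_mem_cyl hxδ hx hl) hy
  by_cases hxδ : x ∈ cyl δ
  · simp [chi, hxδ, key x y hx hy hxδ]
  · have : y ∉ cyl δ := fun h => hxδ (key y x hy hx h)
    simp [chi, hxδ, this]

theorem isPiSystem_cyl : IsPiSystem (insert ∅ (Set.range (cyl (D := D)))) := by
  have key : ∀ γ δ : FinPath D, γ.length ≤ δ.length →
      cyl γ ∩ cyl δ ∈ insert ∅ (Set.range (cyl (D := D))) := by
    intro γ δ hl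
    by_cases h : γ <+: δ
    · exact Or.inr ⟨δ, (Set.inter_eq_right.2 (cyl_subset h)).symm⟩
    · exact Or.inl (Set.disjoint_iff_inter_eq_empty.1 (cyl_disjoint hl h))
  rintro _ (rfl | ⟨γ, rfl⟩) _ (rfl | ⟨δ, rfl⟩) hne
  · simp
  · simp
  · simp
  · rcases le_total γ.length δ.length with h | h
    · exact key γ δ h
    · rw [Set.inter_comm]; exact key δ γ h

theorem generateFrom_cyl :
    MeasurableSpace.pi = MeasurableSpace.generateFrom (insert ∅ (Set.range (cyl (D := D)))) := by
  apply le_antisymm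
  · refine iSup_le fun n => ?_
    rintro _ ⟨t, -, rfl⟩
    have : (fun x : InfPath D => x n) ⁻¹' t =
        ⋃ γ : {γ : FinPath D // γ.length = n}, ⋃ v : t, cyl (extend γ.1 v.1) := by
      ext x
      simp only [Set.mem_preimage, Set.mem_iUnion, mem_cyl_extend]
      constructor
      · intro h
        exact ⟨⟨(List.range n).map x, by simp⟩, ⟨x n, h⟩, by simp [mem_cyl_iff], by simp⟩
      · rintro ⟨⟨γ, rfl⟩, ⟨v, hv⟩, _, h⟩; rwa [h]
    change MeasurableSet[MeasurableSpace.generateFrom (insert ∅ (Set.range (cyl (D := D))))]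
      ((fun x : InfPath D => x n) ⁻¹' t)
    rw [this]
    exact @MeasurableSet.iUnion _ _ (MeasurableSpace.generateFrom _) _ _ fun γ =>
      @MeasurableSet.iUnion _ _ (MeasurableSpace.generateFrom _) _ _ fun v =>
        MeasurableSpace.measurableSet_generateFrom (Or.inr ⟨_, rfl⟩)
  · refine MeasurableSpace.generateFrom_le ?_
    rintro _ (rfl | ⟨γ, rfl⟩)
    · exact MeasurableSet.empty
    · exact measurableSet_cyl γ

theorem eq_zero_of_setIntegral_cyl [NeZero D] {f : InfPath D → ℂ} (hf : Integrable f (muD D))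
    (h : ∀ γ, ∫ x in cyl γ, f x ∂(muD D) = 0) : f =ᵐ[muD D] 0 := by
  refine hf.ae_eq_zero_of_forall_setIntegral_eq_zero fun s hs _ => ?_
  -- The whole space is the cylinder of the empty path; this drives the complement step of the π-λ
  -- induction.
  have huniv : ∫ x, f x ∂(muD D) = 0 := by
    have := h []; rwa [cyl_nil, setIntegral_univ] at this
  refine MeasurableSpace.induction_on_inter
    (C := fun s _ => ∫ x in s, f x ∂(muD D) = 0) generateFrom_cyl isPiSystem_cyl
    (by simp) ?_ ?_ ?_ s hs
  · rintro _ (rfl | ⟨γ, rfl⟩)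
    · simp
    · exact h γ
  · intro t ht h0
    have := integral_add_compl ht hf
    rwa [h0, huniv, zero_add] at this
  · intro t hd hm h0
    rw [integral_iUnion hm hd hf.integrableOn]
    simp [h0]

/-! ### The Dixmier trace -/

/-- Group paths by number of vertices: `D^n` paths of weight `D^(-n)` each give a geometric series
of ratio `D^(1-t) < 1`. -/
theorem summable_wD_rpow [NeZero D] (hD : 2 ≤ D) {t : ℝ} (ht : 1 < t) :
    Summable fun η : FinPath D => wD η ^ t := by
  have hD0 : (0 : ℝ) < D := Nat.cast_pos.2 (NeZero.pos D)
  have hD1 : (1 : ℝ) < D := by exact_mod_cast hD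
  rw [← (Equiv.sigmaFiberEquiv (List.length : FinPath D → ℕ)).summable_iff]
  have hfin : ∀ n, Finite {η : FinPath D // η.length = n} := fun n =>
    inferInstanceAs (Finite (List.Vector (Fin D) n))
  have hval : ∀ n (η : {η : FinPath D // η.length = n}),
      wD η.1 ^ t = ((D : ℝ) ^ (-t)) ^ n := by
    rintro n ⟨η, rfl⟩
    rw [wD_eq, ← Real.rpow_natCast, ← Real.rpow_natCast, ← Real.rpow_neg hD0.le,
      ← Real.rpow_mul hD0.le, ← Real.rpow_mul hD0.le]
    congr 1; ring
  refine (summable_sigma_of_nonneg fun x => Real.rpow_nonneg (wD_pos _).le _).2 ⟨fun n => Summable.of_finite, ?_⟩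
  have : (fun n => ∑' η : {η : FinPath D // η.length = n}, wD η.1 ^ t) =
      fun n => ((D : ℝ) ^ (1 - t)) ^ n := by
    ext n
    have hc : Nat.card {η : FinPath D // η.length = n} = D ^ n := by
      change Nat.card (List.Vector (Fin D) n) = _
      rw [Nat.card_eq_fintype_card, card_vector, Fintype.card_fin]
    simp_rw [hval n]
    rw [tsum_const, hc, nsmul_eq_mul, Nat.cast_pow, ← mul_pow, sub_eq_add_neg,
      Real.rpow_add hD0, Real.rpow_one]
  change Summable fun n => ∑' η : {η : FinPath D // η.length = n}, wD η.1 ^ t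
  rw [this]
  exact summable_geometric_of_lt_one (by positivity)
    (Real.rpow_lt_one_of_one_lt_of_neg hD1 (by linarith))

theorem wD_append [NeZero D] (γ δ : FinPath D) : wD (γ ++ δ) = wD γ * wD δ := by
  simp only [wD_eq, List.length_append, pow_add, mul_inv]

/-- Continuations of a path, identified with paths. -/
def prefixEquiv (γ : FinPath D) : FinPath D ≃ {η : FinPath D // γ <+: η} :=
  Equiv.ofBijective (fun δ => ⟨γ ++ δ, List.prefix_append _ _⟩)
    ⟨fun _ _ h => List.append_cancel_left (congrArg Subtype.val h), fun ⟨_, t, ht⟩ =>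
      ⟨t, Subtype.ext ht⟩⟩

/-- The weight is multiplicative under concatenation, so the numerator is `w(γ)^t` times the
denominator; for `t > 1` the quotient is exactly `w(γ)^t`. -/
theorem isDixmierMeasure_muD [NeZero D] (hD : 2 ≤ D) : IsDixmierMeasure D (muD D) := by
  intro γ
  rw [muD_cyl]
  have hlim : Tendsto (fun t : ℝ => wD γ ^ t) (𝓝[>] 1) (𝓝 (wD γ)) := by
    have : ContinuousAt (fun t : ℝ => wD γ ^ t) 1 :=
      Real.continuousAt_const_rpow (wD_pos γ).ne'
    have h := this.tendsto.mono_left (nhdsWithin_le_nhds (s := Set.Ioi 1))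
    rwa [Real.rpow_one] at h
  refine hlim.congr' ?_
  filter_upwards [self_mem_nhdsWithin] with t ht
  have hs := summable_wD_rpow (D := D) hD (show 1 < t from ht)
  have hpos : 0 < ∑' η : FinPath D, wD η ^ t :=
    hs.tsum_pos (fun η => Real.rpow_nonneg (wD_pos η).le _) [] (Real.rpow_pos_of_pos (wD_pos _) _)
  rw [eq_div_iff hpos.ne', ← tsum_mul_left,
    ← (prefixEquiv γ).tsum_eq (fun η : {η : FinPath D // γ <+: η} => wD η.1 ^ t)]
  refine tsum_congr fun δ => ?_
  change _ = wD (γ ++ δ) ^ t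
  rw [wD_append, Real.mul_rpow (wD_pos _).le (wD_pos _).le]

/-! ### The form on finitely many blocks -/

/-- The expectation of `conj (f x - f y) * (g x - g y)` over the choice pairs at `γ`. -/
def blockForm (γ : FinPath D) (f g : InfPath D → ℂ) : ℂ :=
  ∫ p, (starRingEnd ℂ) (f p.1 - f p.2) * (g p.1 - g p.2)
    ∂(ProbabilityTheory.cond ((muD D).prod (muD D)) (choicePairs γ))

theorem integrable_conj_mul {f g : InfPath D → ℂ} (hf : MemLp f 2 (muD D))
    (hg : MemLp g 2 (muD D)) : Integrable (fun x => (starRingEnd ℂ) (f x) * g x) (muD D) :=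
  hf.star.integrable_mul hg

/-- The covariance identity: multiply out and separate the variables. -/
theorem setIntegral_prod_sub [NeZero D] {f g : InfPath D → ℂ} (hf : MemLp f 2 (muD D))
    (hg : MemLp g 2 (muD D)) (A : Set (InfPath D)) :
    ∫ p in A ×ˢ A, (starRingEnd ℂ) (f p.1 - f p.2) * (g p.1 - g p.2) ∂((muD D).prod (muD D)) =
      2 * ((muD D).real A * ∫ x in A, (starRingEnd ℂ) (f x) * g x ∂(muD D) -
        (∫ x in A, (starRingEnd ℂ) (f x) ∂(muD D)) * ∫ x in A, g x ∂(muD D)) := by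
  have hgi := hg.integrable one_le_two
  have hsi : Integrable (fun x => (starRingEnd ℂ) (f x)) (muD D) :=
    hf.star.integrable one_le_two
  have hfg := integrable_conj_mul hf hg
  have h1 : Integrable (fun _ : InfPath D => (1 : ℂ)) (muD D) := integrable_const _
  have i1 := (hfg.mul_prod h1).integrableOn (s := A ×ˢ A)
  have i2 := (hsi.mul_prod hgi).integrableOn (s := A ×ˢ A)
  have i3 := (hgi.mul_prod hsi).integrableOn (s := A ×ˢ A)
  have i4 := (h1.mul_prod hfg).integrableOn (s := A ×ˢ A)
  -- The factors `1` put all four terms in product form for Fubini.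
  have e : ∀ p : InfPath D × InfPath D, (starRingEnd ℂ) (f p.1 - f p.2) * (g p.1 - g p.2) =
      ((starRingEnd ℂ) (f p.1) * g p.1 * 1 - (starRingEnd ℂ) (f p.1) * g p.2) -
      (g p.1 * (starRingEnd ℂ) (f p.2) - 1 * ((starRingEnd ℂ) (f p.2) * g p.2)) := by
    intro p; rw [map_sub]; ring
  simp_rw [e]
  refine (integral_sub (i1.sub i2) (i3.sub i4)).trans ?_
  rw [integral_sub' i1 i2, integral_sub' i3 i4,
    setIntegral_prod_mul (fun x => (starRingEnd ℂ) (f x) * g x) (fun _ => (1 : ℂ)),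
    setIntegral_prod_mul (fun x => (starRingEnd ℂ) (f x)) g,
    setIntegral_prod_mul g (fun x => (starRingEnd ℂ) (f x)),
    setIntegral_prod_mul (fun _ => (1 : ℂ)) (fun x => (starRingEnd ℂ) (f x) * g x)]
  simp only [setIntegral_const, Complex.real_smul, mul_one]
  ring

theorem integrable_prod_sub [NeZero D] {f g : InfPath D → ℂ} (hf : MemLp f 2 (muD D))
    (hg : MemLp g 2 (muD D)) :
    Integrable (fun p : InfPath D × InfPath D =>
      (starRingEnd ℂ) (f p.1 - f p.2) * (g p.1 - g p.2)) ((muD D).prod (muD D)) := by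
  have h1 : MemLp (fun p : InfPath D × InfPath D => f p.1 - f p.2) 2 ((muD D).prod (muD D)) :=
    (hf.comp_fst _).sub (hf.comp_snd _)
  have h2 : MemLp (fun p : InfPath D × InfPath D => g p.1 - g p.2) 2 ((muD D).prod (muD D)) :=
    (hg.comp_fst _).sub (hg.comp_snd _)
  exact h1.star.integrable_mul h2

theorem setIntegral_choicePairs [NeZero D] (hD : 2 ≤ D) (γ : FinPath D) {E : Type*}
    [NormedAddCommGroup E] [NormedSpace ℝ E] {F : InfPath D × InfPath D → E}
    (hF : Integrable F ((muD D).prod (muD D))) :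
    ∫ p in choicePairs γ, F p ∂((muD D).prod (muD D)) =
      ∫ p in cyl γ ×ˢ cyl γ, F p ∂((muD D).prod (muD D)) -
        ∑ v, ∫ p in cyl (extend γ v) ×ˢ cyl (extend γ v), F p ∂((muD D).prod (muD D)) := by
  have hm : ∀ v, MeasurableSet (cyl (extend γ v) ×ˢ cyl (extend γ v)) := fun v =>
    (measurableSet_cyl _).prod (measurableSet_cyl _)
  rw [choicePairs_eq hD, setIntegral_sdiff (MeasurableSet.iUnion hm) hF.integrableOn,
    integral_iUnion_fintype hm]
  · exact fun v w hvw => Set.disjoint_prod.2 (Or.inl (pairwise_disjoint_extend γ hvw))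
  · exact fun v => hF.integrableOn
  · exact Set.iUnion_subset fun v => Set.prod_mono
      (cyl_subset (List.prefix_append _ _)) (cyl_subset (List.prefix_append _ _))

theorem measureReal_choicePairs [NeZero D] (hD : 2 ≤ D) (γ : FinPath D) :
    ((muD D).prod (muD D)).real (choicePairs γ) = wD γ ^ 2 * (1 - 1 / D) := by
  have hD0 : (D : ℝ) ≠ 0 := NeZero.ne _
  have := setIntegral_choicePairs hD γ (integrable_const (1 : ℝ))
  simp only [setIntegral_const, smul_eq_mul, mul_one, measureReal_prod_prod, muD_cyl,
    wD_extend, Finset.sum_const, Finset.card_univ, Fintype.card_fin, nsmul_eq_mul] at this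
  rw [this]
  field_simp

theorem one_sub_inv_pos (hD : 2 ≤ D) : (0 : ℝ) < 1 - 1 / D := by
  have hD1 : (1 : ℝ) < D := by exact_mod_cast hD
  rw [sub_pos, div_lt_one (by linarith)]; exact hD1

theorem isProbabilityMeasure_choice [NeZero D] (hD : 2 ≤ D) (γ : FinPath D) :
    IsProbabilityMeasure (ProbabilityTheory.cond ((muD D).prod (muD D)) (choicePairs γ)) := by
  refine ProbabilityTheory.cond_isProbabilityMeasure fun h => ?_
  have h1 := measureReal_choicePairs hD γ
  rw [measureReal_def, h] at h1
  have := mul_pos (pow_pos (wD_pos γ) 2) (one_sub_inv_pos hD)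
  simp only [ENNReal.toReal_zero] at h1
  exact this.ne h1

theorem setIntegral_extend [NeZero D] (γ : FinPath D) {F : InfPath D → ℂ}
    (hF : Integrable F (muD D)) :
    ∑ v, ∫ x in cyl (extend γ v), F x ∂(muD D) = ∫ x in cyl γ, F x ∂(muD D) := by
  rw [← iUnion_extend γ, integral_iUnion_fintype (fun v => measurableSet_cyl _)
    (pairwise_disjoint_extend γ) (fun v => hF.integrableOn)]

/-- Apply the covariance identity to `[γ]` and to its children. The children's integrals of `conj f
* g` add up to the one over `[γ]`, with coefficient `w(γ) - w(γ)/D`. -/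
theorem blockForm_eq [NeZero D] (hD : 2 ≤ D) (γ : FinPath D) {f g : InfPath D → ℂ}
    (hf : MemLp f 2 (muD D)) (hg : MemLp g 2 (muD D)) :
    blockForm γ f g = 2 * ((wD γ ^ 2 * (1 - 1 / D) : ℝ) : ℂ)⁻¹ *
      ((wD γ * (1 - 1 / D) : ℝ) * ∫ x in cyl γ, (starRingEnd ℂ) (f x) * g x ∂(muD D) -
        (∫ x in cyl γ, (starRingEnd ℂ) (f x) ∂(muD D)) * (∫ x in cyl γ, g x ∂(muD D)) +
        ∑ v, (∫ x in cyl (extend γ v), (starRingEnd ℂ) (f x) ∂(muD D)) *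
          ∫ x in cyl (extend γ v), g x ∂(muD D)) := by
  rw [blockForm, ProbabilityTheory.cond, integral_smul_measure, ENNReal.toReal_inv,
    ← measureReal_def, measureReal_choicePairs hD,
    setIntegral_choicePairs hD γ (integrable_prod_sub hf hg)]
  simp_rw [setIntegral_prod_sub hf hg, muD_cyl, wD_extend]
  rw [← Finset.mul_sum, Finset.sum_sub_distrib, ← Finset.mul_sum,
    setIntegral_extend γ (integrable_conj_mul hf hg), Complex.real_smul]
  push_cast
  ring

theorem integrable_blockForm [NeZero D] (hD : 2 ≤ D) (γ : FinPath D) {f g : InfPath D → ℂ}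
    (hf : MemLp f 2 (muD D)) (hg : MemLp g 2 (muD D)) :
    Integrable (fun p : InfPath D × InfPath D =>
      (starRingEnd ℂ) (f p.1 - f p.2) * (g p.1 - g p.2))
      (ProbabilityTheory.cond ((muD D).prod (muD D)) (choicePairs γ)) := by
  have := isProbabilityMeasure_choice hD γ
  refine (integrable_prod_sub hf hg).integrableOn.smul_measure ?_
  refine ENNReal.inv_ne_top.2 fun h => ?_
  exact IsProbabilityMeasure.ne_zero _ (ProbabilityTheory.cond_eq_zero_of_meas_eq_zero h)

theorem blockForm_add_left [NeZero D] (hD : 2 ≤ D) (γ : FinPath D) {f f' g : InfPath D → ℂ}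
    (hf : MemLp f 2 (muD D)) (hf' : MemLp f' 2 (muD D)) (hg : MemLp g 2 (muD D)) :
    blockForm γ (f + f') g = blockForm γ f g + blockForm γ f' g := by
  rw [blockForm, blockForm, blockForm, ← integral_add (integrable_blockForm hD γ hf hg)
    (integrable_blockForm hD γ hf' hg)]
  refine integral_congr_ae (Eventually.of_forall fun p => ?_)
  simp only [Pi.add_apply, map_sub, map_add]
  ring

theorem blockForm_smul_left (γ : FinPath D) (c : ℂ) (f g : InfPath D → ℂ) :
    blockForm γ (c • f) g = (starRingEnd ℂ) c * blockForm γ f g := by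
  rw [blockForm, blockForm, ← integral_const_mul]
  refine integral_congr_ae (Eventually.of_forall fun p => ?_)
  simp only [Pi.smul_apply, smul_eq_mul, map_sub, map_mul]
  ring

/-- If `f` is locally constant off finitely many blocks, the trace is almost surely a finite sum,
and each summand depends on one coordinate of `τ`, distributed as the conditioned product measure.
The factor `½` cancels the `2` from the trace of a block. Nothing beyond square integrability is
asked of `g`. -/
theorem formQ_eq_sum [NeZero D] (hD : 2 ≤ D) (s : ℝ) {f g : InfPath D → ℂ}
    (hf : MemLp f 2 (muD D)) (hg : MemLp g 2 (muD D)) (F : Finset (FinPath D))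
    (hF : ∀ γ ∉ F, ∀ p ∈ choicePairs γ, f p.1 = f p.2) :
    formQ D s f g = ∑ γ ∈ F, ((wD γ ^ (s - 2) : ℝ) : ℂ) * blockForm γ f g := by
  have hP := isProbabilityMeasure_choice (D := D) hD
  have hmp := fun γ => measurePreserving_eval_infinitePi
    (fun γ : FinPath D => ProbabilityTheory.cond ((muD D).prod (muD D)) (choicePairs γ)) γ
  -- There are countably many finite paths, so admissibility at each of them almost surely gives it
  -- at all.
  have hae : ∀ᵐ τ ∂(choiceMeasure D), τ ∈ choiceFunctions D := by
    change ∀ᵐ τ ∂(choiceMeasure D), ∀ γ, τ γ ∈ choicePairs γ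
    rw [ae_all_iff]
    exact fun γ => (hmp γ).quasiMeasurePreserving.ae
      (ProbabilityTheory.ae_cond_mem (measurableSet_choicePairs hD γ))
  have hint := fun γ => integrable_blockForm hD γ hf hg
  rw [formQ, Measure.restrict_eq_self_of_ae_mem hae]
  have h1 : ∀ᵐ τ ∂(choiceMeasure D),
      blockTrace (fun γ => CFC.abs (dirac γ) ^ (-s) * star (diracComm τ f γ) * diracComm τ g γ) =
      ∑ γ ∈ F, 2 * ((wD γ ^ (s - 2) : ℝ) : ℂ) *
        ((starRingEnd ℂ) (f (τ γ).1 - f (τ γ).2) * (g (τ γ).1 - g (τ γ).2)) := by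
    filter_upwards [hae] with τ hτ
    rw [blockTrace]
    simp_rw [trace_block]
    refine tsum_eq_sum fun γ hγ => ?_
    rw [hF γ hγ _ (hτ γ)]; simp
  rw [integral_congr_ae h1, integral_finsetSum, Finset.mul_sum]
  · refine Finset.sum_congr rfl fun γ _ => ?_
    rw [integral_const_mul]
    have : ∫ τ, (starRingEnd ℂ) (f (τ γ).1 - f (τ γ).2) * (g (τ γ).1 - g (τ γ).2)
        ∂(choiceMeasure D) = blockForm γ f g := by
      rw [blockForm, ← (hmp γ).map_eq, integral_map (hmp γ).measurable.aemeasurable]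
      · rfl
      · rw [(hmp γ).map_eq]; exact (hint γ).aestronglyMeasurable
    rw [this]; ring
  · exact fun γ _ => ((hmp γ).integrable_comp_of_integrable (hint γ)).const_mul _

/-! ### Locally constant functions -/

theorem memLp_chi [NeZero D] (γ : FinPath D) : MemLp (chi γ) 2 (muD D) :=
  (memLp_const (1 : ℂ)).indicator (measurableSet_cyl γ)

theorem memLp_domQ [NeZero D] {f : InfPath D → ℂ} (hf : f ∈ domQ D) : MemLp f 2 (muD D) := by
  induction hf using Submodule.span_induction with
  | mem f h => obtain ⟨γ, rfl⟩ := h; exact memLp_chi γ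
  | zero => exact MemLp.zero
  | add f g _ _ hf hg => exact hf.add hg
  | smul c f _ hf => exact hf.const_smul c

theorem chi_mem_domQ (γ : FinPath D) : chi γ ∈ domQ D := Submodule.subset_span ⟨γ, rfl⟩

theorem chi_eq_of_not_prefix (hD : 2 ≤ D) {γ δ : FinPath D} (h : γ <+: δ → δ.length ≤ γ.length)
    {p : InfPath D × InfPath D} (hp : p ∈ choicePairs γ) : chi δ p.1 = chi δ p.2 :=
  chi_eq_of_mem h ((mem_choicePairs hD).1 hp).1 ((mem_choicePairs hD).1 hp).2.1

/-- The initial segments of a path. -/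
def prefixes (η : FinPath D) : Finset (FinPath D) :=
  (Finset.range (η.length + 1)).image fun k => η.take k

theorem mem_prefixes {γ η : FinPath D} (h : γ <+: η) : γ ∈ prefixes η := by
  refine Finset.mem_image.2 ⟨γ.length, ?_, (List.prefix_iff_eq_take.1 h).symm⟩
  have := h.length_le
  simp only [Finset.mem_range]; omega

theorem exists_finset_domQ (hD : 2 ≤ D) {f : InfPath D → ℂ} (hf : f ∈ domQ D) :
    ∃ F : Finset (FinPath D), ∀ γ ∉ F, ∀ p ∈ choicePairs γ, f p.1 = f p.2 := by
  induction hf using Submodule.span_induction with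
  | mem f h =>
    obtain ⟨δ, rfl⟩ := h
    exact ⟨prefixes δ, fun γ hγ p hp =>
      chi_eq_of_not_prefix hD (fun h => absurd (mem_prefixes h) hγ) hp⟩
  | zero => exact ⟨∅, by simp⟩
  | add f g _ _ hf hg =>
    obtain ⟨F, hF⟩ := hf
    obtain ⟨G, hG⟩ := hg
    refine ⟨F ∪ G, fun γ hγ p hp => ?_⟩
    rw [Finset.notMem_union] at hγ
    simp [hF γ hγ.1 p hp, hG γ hγ.2 p hp]
  | smul c f _ hf =>
    obtain ⟨F, hF⟩ := hf
    exact ⟨F, fun γ hγ p hp => by simp [hF γ hγ p hp]⟩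

theorem formQ_add_left [NeZero D] (hD : 2 ≤ D) (s : ℝ) {f f' g : InfPath D → ℂ}
    (hf : f ∈ domQ D) (hf' : f' ∈ domQ D) (hg : g ∈ domQ D) :
    formQ D s (f + f') g = formQ D s f g + formQ D s f' g := by
  obtain ⟨F, hF⟩ := exists_finset_domQ hD hf
  obtain ⟨G, hG⟩ := exists_finset_domQ hD hf'
  have hF' : ∀ γ ∉ F ∪ G, ∀ p ∈ choicePairs γ, f p.1 = f p.2 := fun γ hγ =>
    hF γ (Finset.notMem_union.1 hγ).1
  have hG' : ∀ γ ∉ F ∪ G, ∀ p ∈ choicePairs γ, f' p.1 = f' p.2 := fun γ hγ =>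
    hG γ (Finset.notMem_union.1 hγ).2
  have mf := memLp_domQ hf
  have mf' := memLp_domQ hf'
  have mg := memLp_domQ hg
  rw [formQ_eq_sum hD s (mf.add mf') mg (F ∪ G), formQ_eq_sum hD s mf mg _ hF',
    formQ_eq_sum hD s mf' mg _ hG', ← Finset.sum_add_distrib]
  · refine Finset.sum_congr rfl fun γ _ => ?_
    rw [blockForm_add_left hD γ mf mf' mg, mul_add]
  · intro γ hγ p hp
    simp [hF' γ hγ p hp, hG' γ hγ p hp]

theorem formQ_smul_left [NeZero D] (hD : 2 ≤ D) (s : ℝ) (c : ℂ) {f g : InfPath D → ℂ}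
    (hf : f ∈ domQ D) (hg : g ∈ domQ D) :
    formQ D s (c • f) g = (starRingEnd ℂ) c * formQ D s f g := by
  obtain ⟨F, hF⟩ := exists_finset_domQ hD hf
  have mf := memLp_domQ hf
  have mg := memLp_domQ hg
  rw [formQ_eq_sum hD s (mf.const_smul c) mg F, formQ_eq_sum hD s mf mg _ hF, Finset.mul_sum]
  · refine Finset.sum_congr rfl fun γ _ => ?_
    rw [blockForm_smul_left]; ring
  · intro γ hγ p hp
    simp [hF γ hγ p hp]

/-! ### Eigenvalues -/

theorem geomQuot_eq (hD : 2 ≤ D) (s : ℝ) (n : ℕ) :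
    geomQuot D s n = ∑ k ∈ Finset.range n, ((D : ℝ) ^ (3 - s)) ^ k := by
  have hD1 : (1 : ℝ) < D := by exact_mod_cast hD
  rw [geomQuot]
  split_ifs with h
  · simp [h]
  · have hq : (D : ℝ) ^ (3 - s) ≠ 1 := by
      intro e
      rw [← Real.rpow_zero (D : ℝ)] at e
      have := (Real.strictMono_rpow_of_base_gt_one hD1).injective e
      exact h (by linarith)
    rw [geom_sum_eq hq, Real.rpow_mul (by linarith), Real.rpow_natCast, ← neg_div_neg_eq]
    simp

/-- The shape in which the form produces the eigenvalue: one term for each proper prefix and a last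
one for `η`. It treats the empty path and `s = 3` uniformly. -/
theorem pathEigenvalue_eq (hD : 2 ≤ D) (s : ℝ) (η : FinPath D) :
    -pathEigenvalue D s η =
      2 * ∑ k ∈ Finset.range η.length, ((D : ℝ) ^ (3 - s)) ^ k +
        2 * (1 - 1 / (D : ℝ))⁻¹ * ((D : ℝ) ^ (3 - s)) ^ η.length := by
  have hD1 : (1 : ℝ) < D := by exact_mod_cast hD
  have hD0 : (0 : ℝ) < D := by linarith
  have hDm : (D : ℝ) - 1 ≠ 0 := by linarith
  have h1 : (1 - 1 / (D : ℝ))⁻¹ = D / (D - 1) := by field_simp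
  rw [h1]
  cases η with
  | nil => simp [pathEigenvalue]; ring
  | cons v γ =>
    have hq : ((D : ℝ) ^ (3 - s)) ^ (γ.length + 1) =
        (D : ℝ) ^ (3 * γ.length + 3) / (D : ℝ) ^ (s * ((γ.length : ℝ) + 1)) := by
      rw [← Real.rpow_natCast, ← Real.rpow_mul hD0.le, ← Real.rpow_natCast,
        ← Real.rpow_sub hD0]
      congr 1; push_cast; ring
    rw [pathEigenvalue, geomQuot_eq hD, List.length_cons, geom_sum_succ, hq]
    have := (Real.rpow_pos_of_pos hD0 (s * ((γ.length : ℝ) + 1))).ne'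
    field_simp
    ring

theorem pathEigenvalue_neg (hD : 2 ≤ D) (s : ℝ) (η : FinPath D) : pathEigenvalue D s η < 0 := by
  have hD0 : (0 : ℝ) < D := by exact_mod_cast (by omega : 0 < D)
  have h1 := one_sub_inv_pos hD
  rw [← neg_pos, pathEigenvalue_eq hD]
  positivity

theorem pathEigenvalue_nil [NeZero D] (hD : 2 ≤ D) (s : ℝ) :
    pathEigenvalue D s [] = -(constG D s [])⁻¹ := by
  have hD1 : (1 : ℝ) < D := by exact_mod_cast hD
  have hD0 : (D : ℝ) ≠ 0 := by linarith
  have hDm : (D : ℝ) - 1 ≠ 0 := by linarith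
  have hn : wD ([] : FinPath D) = 1 := by simp [wD_eq]
  have hc : ((D - 1 : ℕ) : ℝ) = (D : ℝ) - 1 := by
    rw [Nat.cast_sub (by omega), Nat.cast_one]
  simp only [constG, muD_cyl, wD_extend, hn, Real.one_rpow, Finset.sum_const,
    Finset.card_erase_of_mem (Finset.mem_univ _), Finset.card_univ, Fintype.card_fin,
    nsmul_eq_mul, hc, pathEigenvalue]
  field_simp

/-! ### The form on differences of characteristic functions -/

/-- If `γ` is a prefix of `η`, both children lie inside `[γ]` and have equal mass; otherwise `[γ]`
and `[η]` are disjoint. This makes `χ_[ηv] - χ_[ηw]` have mean zero on such `[γ]`. -/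
theorem measureReal_inter_extend [NeZero D] {γ η : FinPath D}
    (h : η <+: γ → γ.length ≤ η.length) (v w : Fin D) :
    (muD D).real (cyl γ ∩ cyl (extend η v)) = (muD D).real (cyl γ ∩ cyl (extend η w)) := by
  have hs : ∀ v, cyl (extend η v) ⊆ cyl η := fun v => cyl_subset (List.prefix_append _ _)
  by_cases hp : γ <+: η
  · rw [Set.inter_eq_right.2 ((hs v).trans (cyl_subset hp)),
      Set.inter_eq_right.2 ((hs w).trans (cyl_subset hp)), muD_cyl, muD_cyl, wD_extend, wD_extend]
  · have hd : Disjoint (cyl γ) (cyl η) := by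
      rcases le_total γ.length η.length with hl | hl
      · exact cyl_disjoint hl hp
      · refine (cyl_disjoint hl fun hpre => hp ?_).symm
        rw [hpre.eq_of_length_le (h hpre)]
    rw [(hd.mono_right (hs v)).inter_eq, (hd.mono_right (hs w)).inter_eq]

/-- The function `χ_[ηv] - χ_[ηw]`. -/
def chiDiff (η : FinPath D) (v w : Fin D) : InfPath D → ℂ := chi (extend η v) - chi (extend η w)

theorem chiDiff_mem_domQ (η : FinPath D) (v w : Fin D) : chiDiff η v w ∈ domQ D :=
  sub_mem (chi_mem_domQ _) (chi_mem_domQ _)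

theorem conj_chi (γ : FinPath D) (x : InfPath D) : (starRingEnd ℂ) (chi γ x) = chi γ x := by
  by_cases h : x ∈ cyl γ <;> simp [chi, h]

theorem conj_chiDiff (η : FinPath D) (v w : Fin D) (x : InfPath D) :
    (starRingEnd ℂ) (chiDiff η v w x) = chiDiff η v w x := by
  simp [chiDiff, conj_chi]

theorem setIntegral_chi [NeZero D] (γ δ : FinPath D) :
    ∫ x in cyl γ, chi δ x ∂(muD D) = (muD D).real (cyl γ ∩ cyl δ) := by
  rw [chi, setIntegral_indicator (measurableSet_cyl δ)]
  simp [measureReal_def]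

theorem setIntegral_chiDiff [NeZero D] {γ η : FinPath D}
    (h : η <+: γ → γ.length ≤ η.length) (v w : Fin D) :
    ∫ x in cyl γ, (starRingEnd ℂ) (chiDiff η v w x) ∂(muD D) = 0 := by
  simp_rw [conj_chiDiff, chiDiff, Pi.sub_apply]
  rw [integral_sub, setIntegral_chi, setIntegral_chi, measureReal_inter_extend h v w, sub_self]
  · exact ((memLp_chi _).integrable one_le_two).integrableOn
  · exact ((memLp_chi _).integrable one_le_two).integrableOn

theorem setIntegral_chiDiff_mul [NeZero D] {γ η : FinPath D} (h : γ <+: η) (v w : Fin D)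
    (g : InfPath D → ℂ) :
    ∫ x in cyl γ, (starRingEnd ℂ) (chiDiff η v w x) * g x ∂(muD D) =
      ∫ x, (starRingEnd ℂ) (chiDiff η v w x) * g x ∂(muD D) := by
  refine setIntegral_eq_integral_of_forall_compl_eq_zero fun x hx => ?_
  have hs : ∀ u, x ∉ cyl (extend η u) := fun u hu =>
    hx (cyl_subset (h.trans (List.prefix_append _ _)) hu)
  simp [chiDiff, chi, hs]

theorem blockForm_chiDiff_of_lt [NeZero D] (hD : 2 ≤ D) {γ η : FinPath D} (h : γ <+: η)
    (hl : γ.length < η.length) (v w : Fin D) {g : InfPath D → ℂ} (hg : MemLp g 2 (muD D)) :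
    blockForm γ (chiDiff η v w) g =
      ((2 * (wD γ)⁻¹ : ℝ) : ℂ) * ∫ x, (starRingEnd ℂ) (chiDiff η v w x) * g x ∂(muD D) := by
  -- The child `γu` is at most as long as `η`, so the mean-zero property still applies.
  have h0 : ∀ u, ∫ x in cyl (extend γ u), (starRingEnd ℂ) (chiDiff η v w x) ∂(muD D) = 0 :=
    fun u => setIntegral_chiDiff (fun _ => by rw [length_extend]; omega) v w
  rw [blockForm_eq hD γ (memLp_domQ (chiDiff_mem_domQ η v w)) hg, setIntegral_chiDiff_mul h,
    setIntegral_chiDiff (fun _ => hl.le)]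
  simp_rw [h0]
  have h1 := (wD_pos γ).ne'
  have h2 := (one_sub_inv_pos hD).ne'
  have e : 2 * (wD γ ^ 2 * (1 - 1 / (D : ℝ)))⁻¹ * (wD γ * (1 - 1 / D)) = 2 * (wD γ)⁻¹ := by
    generalize (1 - 1 / (D : ℝ)) = a at *
    field_simp
  rw [← e]
  push_cast
  simp
  ring

theorem chi_extend {η : FinPath D} {x : InfPath D} (hx : x ∈ cyl η) (v : Fin D) :
    chi (extend η v) x = if x η.length = v then 1 else 0 := by
  rw [chi]
  split_ifs with h
  · rw [Set.indicator_of_mem (mem_cyl_extend.2 ⟨hx, h⟩), Pi.one_apply]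
  · exact Set.indicator_of_notMem (fun hm => h (mem_cyl_extend.1 hm).2) _

/-- On each child the difference is constant, so the product of the two integrals is `w(η)/D` times
the integral of the product. Adding these to the leading term restores `w(η)(1 - 1/D) + w(η)/D =
w(η)`. -/
theorem blockForm_chiDiff_self [NeZero D] (hD : 2 ≤ D) (η : FinPath D)
    (v w : Fin D) {g : InfPath D → ℂ} (hg : MemLp g 2 (muD D)) :
    blockForm η (chiDiff η v w) g =
      ((2 * (wD η)⁻¹ * (1 - 1 / (D : ℝ))⁻¹ : ℝ) : ℂ) *
        ∫ x, (starRingEnd ℂ) (chiDiff η v w x) * g x ∂(muD D) := by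
  have hm := memLp_domQ (chiDiff_mem_domQ η v w)
  have h0 : ∀ u, (∫ x in cyl (extend η u), (starRingEnd ℂ) (chiDiff η v w x) ∂(muD D)) *
      (∫ x in cyl (extend η u), g x ∂(muD D)) =
      ((wD η / D : ℝ) : ℂ) *
        ∫ x in cyl (extend η u), (starRingEnd ℂ) (chiDiff η v w x) * g x ∂(muD D) := by
    intro u
    obtain ⟨a, ha⟩ : ∃ a : ℂ, ∀ x ∈ cyl (extend η u),
        (starRingEnd ℂ) (chiDiff η v w x) = a := by
      refine ⟨(if u = v then 1 else 0) - (if u = w then 1 else 0), fun x hx => ?_⟩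
      obtain ⟨hη, hu⟩ := mem_cyl_extend.1 hx
      rw [conj_chiDiff]
      rw [chiDiff, Pi.sub_apply, chi_extend hη, chi_extend hη, hu]
    have e : ∫ x in cyl (extend η u), (starRingEnd ℂ) (chiDiff η v w x) * g x ∂(muD D) =
        ∫ x in cyl (extend η u), a * g x ∂(muD D) :=
      setIntegral_congr_fun (measurableSet_cyl _) fun x hx => congrArg (· * g x) (ha x hx)
    rw [setIntegral_congr_fun (measurableSet_cyl _) ha, e, integral_const_mul, setIntegral_const, muD_cyl, wD_extend, Complex.real_smul]
    ring
  rw [blockForm_eq hD η hm hg, setIntegral_chiDiff (fun _ => le_rfl)]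
  simp_rw [h0]
  rw [← Finset.mul_sum, setIntegral_extend η (integrable_conj_mul hm hg),
    setIntegral_chiDiff_mul List.prefix_rfl]
  have h1 := (wD_pos η).ne'
  have h2 := (one_sub_inv_pos hD).ne'
  have e : 2 * (wD η ^ 2 * (1 - 1 / (D : ℝ)))⁻¹ * (wD η * (1 - 1 / D) + wD η / D) =
      2 * (wD η)⁻¹ * (1 - 1 / (D : ℝ))⁻¹ := by
    have : wD η * (1 - 1 / D) + wD η / D = wD η := by ring
    rw [this]
    generalize (1 - 1 / (D : ℝ)) = a at *
    field_simp
  rw [← e]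
  push_cast
  ring

/-- Source of the ratio `D^(3-s)`: exponent `s - 2` from the trace and `-1` from the block
expectation. -/
theorem wD_rpow_mul_inv [NeZero D] (s : ℝ) (γ : FinPath D) :
    wD γ ^ (s - 2) * (wD γ)⁻¹ = ((D : ℝ) ^ (3 - s)) ^ γ.length := by
  have hD0 : (0 : ℝ) < D := Nat.cast_pos.2 (NeZero.pos D)
  rw [← Real.rpow_neg_one, ← Real.rpow_add (wD_pos γ), wD_eq, ← Real.rpow_natCast,
    ← Real.rpow_natCast, ← Real.rpow_neg hD0.le, ← Real.rpow_mul hD0.le, ← Real.rpow_mul hD0.le]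
  congr 1; ring

theorem formQ_chiDiff [NeZero D] (hD : 2 ≤ D) (s : ℝ) (η : FinPath D) (v w : Fin D)
    {g : InfPath D → ℂ} (hg : MemLp g 2 (muD D)) :
    formQ D s (chiDiff η v w) g = -(pathEigenvalue D s η : ℂ) *
      ∫ x, (starRingEnd ℂ) (chiDiff η v w x) * g x ∂(muD D) := by
  rw [formQ_eq_sum hD s (memLp_domQ (chiDiff_mem_domQ η v w)) hg (prefixes η)]
  · rw [prefixes, Finset.sum_image, Finset.sum_range_succ, List.take_length,
      blockForm_chiDiff_self hD η v w hg]
    · have hk : ∀ k ∈ Finset.range η.length,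
          ((wD (η.take k) ^ (s - 2) : ℝ) : ℂ) * blockForm (η.take k) (chiDiff η v w) g =
          ((2 * ((D : ℝ) ^ (3 - s)) ^ k : ℝ) : ℂ) *
            ∫ x, (starRingEnd ℂ) (chiDiff η v w x) * g x ∂(muD D) := by
        intro k hk
        have hl : (η.take k).length = k := by
          rw [List.length_take]; exact min_eq_left (Finset.mem_range.1 hk).le
        rw [blockForm_chiDiff_of_lt hD (List.take_prefix _ _)
          (by rw [hl]; exact Finset.mem_range.1 hk) v w hg]
        have e := wD_rpow_mul_inv s (η.take k)
        rw [hl] at e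
        rw [← e]; push_cast; ring
      rw [Finset.sum_congr rfl hk, ← Finset.sum_mul, ← mul_assoc, ← add_mul,
        ← Complex.ofReal_neg, pathEigenvalue_eq hD, ← wD_rpow_mul_inv s η, Finset.mul_sum]
      push_cast
      ring
    · intro a ha b hb hab
      have := congrArg List.length hab
      simp only [Finset.coe_range, Set.mem_Iio] at ha hb
      simp only [List.length_take] at this
      omega
  · intro γ hγ p hp
    -- A prefix of `ηu` that is not a prefix of `η` must be `ηu` itself.
    have h : ∀ u, γ <+: extend η u → (extend η u).length ≤ γ.length := by
      intro u hu
      by_contra hl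
      rw [length_extend] at hl
      exact hγ (mem_prefixes
        (List.prefix_of_prefix_length_le hu (List.prefix_append _ _) (by omega)))
    simp only [chiDiff, Pi.sub_apply]
    rw [chi_eq_of_not_prefix hD (h v) hp, chi_eq_of_not_prefix hD (h w) hp]

/-! ### The decomposition of `L²` -/

section Decomposition

open scoped InnerProductSpace

/-- The inclusion of `Dom Q_s` in `L²`. -/
def toL2 (D : ℕ) [NeZero D] : domQ D →ₗ[ℂ] L2 D where
  toFun f := (memLp_domQ f.2).toLp f.1
  map_add' f g := MemLp.toLp_add (memLp_domQ f.2) (memLp_domQ g.2)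
  map_smul' c f := MemLp.toLp_const_smul c (memLp_domQ f.2)

theorem toL2_chi [NeZero D] (γ : FinPath D) : toL2 D ⟨chi γ, chi_mem_domQ γ⟩ = chiL2 γ := rfl

theorem inner_toL2 [NeZero D] (f : domQ D) (h : L2 D) :
    ⟪toL2 D f, h⟫_ℂ = ∫ x, (starRingEnd ℂ) (f.1 x) * h x ∂(muD D) := by
  rw [L2.inner_def]
  refine integral_congr_ae ?_
  filter_upwards [(memLp_domQ f.2).coeFn_toLp] with x hx
  change ⟪(MemLp.toLp f.1 (memLp_domQ f.2)) x, h x⟫_ℂ = _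
  rw [hx, RCLike.inner_apply, mul_comm]

theorem inner_toL2_toL2 [NeZero D] (f g : domQ D) :
    ⟪toL2 D f, toL2 D g⟫_ℂ = ∫ x, (starRingEnd ℂ) (f.1 x) * g.1 x ∂(muD D) := by
  rw [inner_toL2]
  refine integral_congr_ae ?_
  filter_upwards [(memLp_domQ g.2).coeFn_toLp] with x hx
  change _ * (MemLp.toLp g.1 (memLp_domQ g.2)) x = _
  rw [hx]

theorem inner_chiL2 [NeZero D] (γ : FinPath D) (h : L2 D) :
    ⟪chiL2 γ, h⟫_ℂ = ∫ x in cyl γ, h x ∂(muD D) :=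
  L2.inner_indicatorConstLp_one _ _ h

theorem inner_chiL2_chiL2 [NeZero D] (γ δ : FinPath D) :
    ⟪chiL2 γ, chiL2 δ⟫_ℂ = (muD D).real (cyl γ ∩ cyl δ) :=
  L2.inner_indicatorConstLp_one_indicatorConstLp_one (measurableSet_cyl γ) (measurableSet_cyl δ)
    (measure_ne_top _ _) (measure_ne_top _ _)

theorem constSpace_eq [NeZero D] : constSpace D = Submodule.span ℂ {chiL2 ([] : FinPath D)} := by
  unfold constSpace chiL2
  congr 3
  exact cyl_nil.symm

theorem inner_chiL2_sub [NeZero D] {γ η : FinPath D} (h : η <+: γ → γ.length ≤ η.length)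
    (v w : Fin D) : ⟪chiL2 γ, chiL2 (extend η v) - chiL2 (extend η w)⟫_ℂ = 0 := by
  rw [inner_sub_right, inner_chiL2_chiL2, inner_chiL2_chiL2, measureReal_inter_extend h v w,
    sub_self]

/-- A generator for the longer path `θ` has mean zero on every cylinder `[ηv]`, because `ηv` cannot
properly extend `θ`. -/
theorem pathEigenspace_ortho [NeZero D] {η θ : FinPath D} (hne : η ≠ θ)
    (hl : η.length ≤ θ.length) : pathEigenspace η ⟂ pathEigenspace θ := by
  refine Submodule.isOrtho_span.2 ?_
  rintro _ ⟨v, v', _, rfl⟩ _ ⟨w, w', _, rfl⟩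
  have h : ∀ u, θ <+: extend η u → (extend η u).length ≤ θ.length := by
    intro u hu
    by_contra hlt
    rw [length_extend] at hlt
    have := List.prefix_of_prefix_length_le hu (List.prefix_append η [u]) (by omega)
    exact hne (this.eq_of_length_le hl).symm
  rw [inner_sub_left, inner_chiL2_sub (h v), inner_chiL2_sub (h v'), sub_self]

theorem constSpace_ortho [NeZero D] (η : FinPath D) : constSpace D ⟂ pathEigenspace η := by
  rw [constSpace_eq]
  refine Submodule.isOrtho_span.2 ?_
  rintro _ rfl _ ⟨w, w', _, rfl⟩
  exact inner_chiL2_sub (by simp) w w'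

theorem decomposition_ortho [NeZero D] {i j : Option (FinPath D)} (h : i ≠ j) :
    decomposition D i ⟂ decomposition D j := by
  match i, j, h with
  | none, none, h => exact absurd rfl h
  | none, some η, _ => exact constSpace_ortho η
  | some η, none, _ => exact (constSpace_ortho η).symm
  | some η, some θ, h =>
    have hne : η ≠ θ := fun e => h (congrArg some e)
    rcases le_total η.length θ.length with hl | hl
    · exact pathEigenspace_ortho hne hl
    · exact (pathEigenspace_ortho hne.symm hl).symm

theorem decomposition_inner [NeZero D] (i j : Option (FinPath D)) (h : i ≠ j) :
    ∀ u ∈ decomposition D i, ∀ v ∈ decomposition D j, ⟪u, v⟫_ℂ = 0 :=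
  fun _ hu _ hv => (decomposition_ortho h).inner_eq hu hv

theorem chiDiff_mem [NeZero D] (η : FinPath D) (v w : Fin D) :
    chiL2 (extend η v) - chiL2 (extend η w) ∈ pathEigenspace η := by
  by_cases h : v = w
  · rw [h, sub_self]; exact zero_mem _
  · exact Submodule.subset_span ⟨v, w, h, rfl⟩

/-- The children of `γ` partition `[γ]`. This is the inductive step expressing every cylinder
function through the constants and the `E_η`. -/
theorem chi_extend_eq [NeZero D] (γ : FinPath D) (v : Fin D) :
    chi (extend γ v) = (D : ℂ)⁻¹ • (chi γ + ∑ w, chiDiff γ v w) := by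
  have hD : (D : ℂ) ≠ 0 := NeZero.ne _
  have h : ∑ w, chi (extend γ w) = chi γ := by
    ext x
    rw [Finset.sum_apply]
    by_cases hx : x ∈ cyl γ
    · simp_rw [chi_extend hx]
      simp [chi, hx]
    · have : ∀ w, x ∉ cyl (extend γ w) := fun w hw => hx (mem_cyl_extend.1 hw).1
      simp [chi, hx, this]
  simp only [chiDiff]
  rw [Finset.sum_sub_distrib, h, Finset.sum_const, Finset.card_univ, Fintype.card_fin,
    add_sub_cancel, ← Nat.cast_smul_eq_nsmul ℂ, smul_smul, inv_mul_cancel₀ hD, one_smul]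

/-- The eigenvalues on the members of `decomposition`. -/
def eigenvalueOf (D : ℕ) (s : ℝ) : Option (FinPath D) → ℝ
  | none => 0
  | some η => pathEigenvalue D s η

/-- The functions in `Dom Q_s` to which the minimal diagonal operator applies and represents the
form. -/
def formDomain (D : ℕ) [NeZero D] (hD : 2 ≤ D) (s : ℝ) : Submodule ℂ (InfPath D → ℂ) where
  carrier := {f | ∃ hf : f ∈ domQ D, ∃ f' : L2 D,
    (toL2 D ⟨f, hf⟩, f') ∈ diagCore (decomposition D) (eigenvalueOf D s) ∧
      ∀ φ : domQ D, formQ D s f φ.1 = -⟪f', toL2 D φ⟫_ℂ}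
  add_mem' := by
    rintro f g ⟨hf, f', h1, h2⟩ ⟨hg, g', h3, h4⟩
    refine ⟨add_mem hf hg, f' + g', add_mem h1 h3, fun φ => ?_⟩
    rw [formQ_add_left hD s hf hg φ.2, h2, h4, inner_add_left, neg_add]
  zero_mem' := by
    refine ⟨zero_mem _, 0, ?_, fun φ => ?_⟩
    · exact zero_mem (diagCore (decomposition D) (eigenvalueOf D s))
    · rw [formQ_eq_sum hD s MemLp.zero (memLp_domQ φ.2) ∅ (by simp)]; simp
  smul_mem' := by
    rintro c f ⟨hf, f', h1, h2⟩
    refine ⟨Submodule.smul_mem _ c hf, c • f', Submodule.smul_mem _ c h1, fun φ => ?_⟩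
    rw [formQ_smul_left hD s c hf φ.2, h2, inner_smul_left, mul_neg]

theorem chiDiff_mem_formDomain [NeZero D] (hD : 2 ≤ D) (s : ℝ) (η : FinPath D) (v w : Fin D) :
    chiDiff η v w ∈ formDomain D hD s := by
  refine ⟨chiDiff_mem_domQ η v w,
    (pathEigenvalue D s η : ℂ) • toL2 D ⟨_, chiDiff_mem_domQ η v w⟩, ?_, fun φ => ?_⟩
  · exact diagCore_of_mem (V := decomposition D) (l := eigenvalueOf D s) (i := some η)
      (chiDiff_mem η v w)
  · rw [formQ_chiDiff hD s η v w (memLp_domQ φ.2), inner_smul_left, inner_toL2_toL2,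
      Complex.conj_ofReal, neg_mul]

theorem chi_mem_formDomain [NeZero D] (hD : 2 ≤ D) (s : ℝ) (γ : FinPath D) :
    chi γ ∈ formDomain D hD s := by
  induction γ using List.reverseRecOn with
  | nil =>
    refine ⟨chi_mem_domQ _, 0, ?_, fun φ => ?_⟩
    · have h := diagCore_of_mem (V := decomposition D) (l := eigenvalueOf D s) (i := none)
        (v := chiL2 []) (by
          change _ ∈ constSpace D
          rw [constSpace_eq]; exact Submodule.mem_span_singleton_self _)
      simp only [eigenvalueOf, Complex.ofReal_zero, zero_smul] at h
      exact h
    · rw [formQ_eq_sum hD s (memLp_chi _) (memLp_domQ φ.2) ∅]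
      · simp
      · intro γ _ p _
        simp [chi, cyl_nil]
  | append_singleton γ v ih =>
    change chi (extend γ v) ∈ _
    rw [chi_extend_eq]
    exact Submodule.smul_mem _ _ (add_mem ih
      (sum_mem fun w _ => chiDiff_mem_formDomain hD s γ v w))

theorem exists_diagCore [NeZero D] (hD : 2 ≤ D) (s : ℝ) (f : domQ D) :
    ∃ f' : L2 D, (toL2 D f, f') ∈ diagCore (decomposition D) (eigenvalueOf D s) ∧
      ∀ φ : domQ D, formQ D s f.1 φ.1 = -⟪f', toL2 D φ⟫_ℂ := by
  have : domQ D ≤ formDomain D hD s := by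
    refine Submodule.span_le.2 ?_
    rintro _ ⟨γ, rfl⟩
    exact chi_mem_formDomain hD s γ
  obtain ⟨_, h⟩ := this f.2
  exact h

theorem decomposition_total [NeZero D] (hD : 2 ≤ D) (x : L2 D)
    (hx : ∀ i, ∀ v ∈ decomposition D i, ⟪v, x⟫_ℂ = 0) : x = 0 := by
  -- The value `s = 0` is arbitrary; only first components matter, and they do not depend on `s`.
  have hcore : ∀ p ∈ diagCore (decomposition D) (eigenvalueOf D 0), ⟪p.1, x⟫_ℂ = 0 := by
    intro p hp
    induction hp using Submodule.span_induction with
    | mem p h => obtain ⟨i, v, hv, rfl⟩ := h; exact hx i v hv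
    | zero => simp
    | add p q _ _ h h' => rw [Prod.fst_add, inner_add_left, h, h', add_zero]
    | smul c p _ h => rw [Prod.smul_fst, inner_smul_left, h, mul_zero]
  refine (Lp.eq_zero_iff_ae_eq_zero).2
    (eq_zero_of_setIntegral_cyl ((Lp.memLp x).integrable one_le_two) fun γ => ?_)
  obtain ⟨f', hf, _⟩ := exists_diagCore hD 0 ⟨chi γ, chi_mem_domQ γ⟩
  rw [← inner_chiL2]
  exact hcore _ hf

theorem exists_toL2_of_diagCore [NeZero D] (s : ℝ) {p : L2 D × L2 D}
    (hp : p ∈ diagCore (decomposition D) (eigenvalueOf D s)) : ∃ f : domQ D, toL2 D f = p.1 := by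
  have hr : ∀ i, decomposition D i ≤ LinearMap.range (toL2 D) := by
    rintro (_ | η)
    · change constSpace D ≤ _
      rw [constSpace_eq, Submodule.span_singleton_le_iff_mem]
      exact ⟨_, toL2_chi _⟩
    · refine Submodule.span_le.2 ?_
      rintro _ ⟨v, w, _, rfl⟩
      exact sub_mem ⟨_, toL2_chi _⟩ ⟨_, toL2_chi _⟩
  have : diagCore (decomposition D) (eigenvalueOf D s) ≤
      (LinearMap.range (toL2 D)).comap (LinearMap.fst ℂ _ _) := by
    refine Submodule.span_le.2 ?_
    rintro _ ⟨i, v, hv, rfl⟩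
    exact hr i hv
  exact this hp

theorem pathEigenspace_ne_bot [NeZero D] (hD : 2 ≤ D) (η : FinPath D) :
    pathEigenspace η ≠ ⊥ := by
  intro h
  have hv : (⟨0, by omega⟩ : Fin D) ≠ ⟨1, by omega⟩ := by simp
  have h0 := chiDiff_mem η (⟨0, by omega⟩ : Fin D) ⟨1, by omega⟩
  rw [h, Submodule.mem_bot] at h0
  have h1 := congrArg (fun u => ⟪chiL2 (extend η (⟨0, by omega⟩ : Fin D)), u⟫_ℂ) h0
  simp only [inner_sub_right, inner_zero_right, inner_chiL2_chiL2, Set.inter_self] at h1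
  rw [(pairwise_disjoint_extend η hv).inter_eq, muD_cyl, measureReal_empty] at h1
  simp [(wD_pos _).ne'] at h1

end Decomposition

/-! ### The Laplace–Beltrami operator -/

section Laplace

open scoped InnerProductSpace

/-- Symmetry of the diagonal operator moves it from the first argument of the form to the second. -/
theorem formQ_eq_of_diagCore [NeZero D] (hD : 2 ≤ D) (s : ℝ) {φ : domQ D} {h : L2 D}
    (hφ : (toL2 D φ, h) ∈ diagCore (decomposition D) (eigenvalueOf D s)) (f : domQ D) :
    formQ D s f.1 φ.1 = -⟪toL2 D f, h⟫_ℂ := by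
  obtain ⟨f', hf, hQ⟩ := exists_diagCore hD s f
  rw [hQ, diagCore_symm hf (diagCore_le decomposition_inner hφ)]

theorem tendsto_toL2_iff [NeZero D] (φ : ℕ → domQ D) (g : L2 D) :
    Tendsto (fun n => toL2 D (φ n)) atTop (𝓝 g) ↔
      Tendsto (fun n => eLpNorm ((φ n).1 - ⇑g) 2 (muD D)) atTop (𝓝 0) := by
  rw [Lp.tendsto_Lp_iff_tendsto_eLpNorm']
  refine iff_of_eq (congrArg (fun F => Tendsto F atTop (𝓝 0)) (funext fun n => ?_))
  exact eLpNorm_congr_ae ((memLp_domQ (φ n).2).coeFn_toLp.sub EventuallyEq.rfl)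

theorem laplaceRel_iff [NeZero D] (hD : 2 ≤ D) (s : ℝ) (g h : L2 D) :
    (g, h) ∈ diagGraph (decomposition D) (eigenvalueOf D s) ↔ LaplaceRel D s g h := by
  constructor
  · intro hgh
    -- A core sequence converging in graph norm serves as `φ`: form values are inner products with
    -- its images, so convergence of both components gives the Cauchy condition and the limit.
    obtain ⟨p, hp, hlim⟩ := mem_closure_iff_seq_limit.1
      (diagGraph_le_closure decomposition_inner (decomposition_total hD) hgh)
    choose φ hφ using fun n => exists_toL2_of_diagCore s (hp n)
    have hcore : ∀ n, (toL2 D (φ n), (p n).2) ∈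
        diagCore (decomposition D) (eigenvalueOf D s) := fun n => by rw [hφ n]; exact hp n
    have l1 : Tendsto (fun n => toL2 D (φ n)) atTop (𝓝 g) := by
      simp_rw [hφ]; exact (continuous_fst.tendsto _).comp hlim
    have l2 : Tendsto (fun n => (p n).2) atTop (𝓝 h) := (continuous_snd.tendsto _).comp hlim
    refine ⟨fun n => (φ n).1, fun n => (φ n).2, (tendsto_toL2_iff φ g).1 l1, ?_, ?_⟩
    · have e : ∀ q : ℕ × ℕ, formQ D s ((φ q.1).1 - (φ q.2).1) ((φ q.1).1 - (φ q.2).1) =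
          -⟪toL2 D (φ q.1) - toL2 D (φ q.2), (p q.1).2 - (p q.2).2⟫_ℂ := by
        intro q
        have := formQ_eq_of_diagCore hD s (φ := φ q.1 - φ q.2) (h := (p q.1).2 - (p q.2).2)
          (by rw [map_sub]; exact sub_mem (hcore q.1) (hcore q.2)) (φ q.1 - φ q.2)
        rwa [map_sub] at this
      simp_rw [e]
      rw [← prod_atTop_atTop_eq]
      have := (((l1.comp tendsto_fst).sub (l1.comp tendsto_snd)).inner (𝕜 := ℂ)
        ((l2.comp tendsto_fst).sub (l2.comp tendsto_snd))).neg
      simpa using this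
    · intro f hf
      have e : ∀ n, formQ D s f (φ n).1 = -⟪toL2 D ⟨f, hf⟩, (p n).2⟫_ℂ := fun n =>
        formQ_eq_of_diagCore hD s (hcore n) ⟨f, hf⟩
      simp_rw [e]
      rw [← inner_toL2 ⟨f, hf⟩ h]
      exact (tendsto_const_nhds.inner l2).neg
  · rintro ⟨φ, hφ, l1, -, l2⟩
    have l1' := (tendsto_toL2_iff (fun n => ⟨φ n, hφ n⟩) g).2 l1
    -- For `f` in the core with image `y`, the limit of `Q_s(f, φ n)` is `-⟪f, h⟫` by assumption and
    -- `-⟪y, g⟫` by symmetry; eigenvectors `f` then give the diagonal relations.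
    have key : ∀ p ∈ diagCore (decomposition D) (eigenvalueOf D s),
        ⟪p.1, h⟫_ℂ = ⟪p.2, g⟫_ℂ := by
      rintro ⟨x, y⟩ hp
      obtain ⟨f, rfl⟩ := exists_toL2_of_diagCore s hp
      have a1 := l2 f.1 f.2
      rw [← inner_toL2] at a1
      have a2 : Tendsto (fun n => formQ D s f.1 (φ n)) atTop (𝓝 (-⟪y, g⟫_ℂ)) := by
        have e : ∀ n, formQ D s f.1 (φ n) = -⟪y, toL2 D ⟨φ n, hφ n⟩⟫_ℂ := by
          intro n
          obtain ⟨f', hf, hQ⟩ := exists_diagCore hD s ⟨φ n, hφ n⟩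
          rw [formQ_eq_of_diagCore hD s hf f, diagCore_symm hp (diagCore_le decomposition_inner hf)]
        simp_rw [e]
        exact (tendsto_const_nhds.inner l1').neg
      exact neg_injective (tendsto_nhds_unique a1 a2)
    intro i v hv
    have := key _ (diagCore_of_mem hv)
    rwa [inner_smul_left, Complex.conj_ofReal] at this

end Laplace

end CuntzBratteli

end

/-! ### Assembly of the spectral statement -/

open CuntzBratteli in
theorem mainTheorem5 (D : ℕ) [NeZero D] (hD : 2 ≤ D) (s : ℝ) :
    IsDixmierMeasure D (muD D) ∧
    ∃ Δ : L2 D →ₗ.[ℂ] L2 D,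
      IsLaplaceBeltrami D s Δ ∧
      IsSelfAdjoint Δ ∧
      (∀ c : ℂ, eigenspaceOf Δ c ≠ ⊥ ↔
        c = 0 ∨ ∃ η : FinPath D, c = (pathEigenvalue D s η : ℂ)) ∧
      eigenspaceOf Δ 0 = constSpace D ∧
      pathEigenvalue D s [] = -(constG D s [])⁻¹ ∧
      (∀ η : FinPath D,
        pathEigenspace η ≠ ⊥ ∧
        pathEigenspace η ≤ eigenspaceOf Δ (pathEigenvalue D s η : ℂ)) ∧
      (∀ c : ℂ, c ≠ 0 →
        eigenspaceOf Δ c =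
          (⨆ η : {η : FinPath D // (pathEigenvalue D s η : ℂ) = c},
            pathEigenspace η.1).topologicalClosure) ∧
      OrthogonalFamily ℂ (fun i => decomposition D i) (fun i => (decomposition D i).subtypeₗᵢ) ∧
      (⨆ i, decomposition D i).topologicalClosure = ⊤ := by
  have hO := decomposition_inner (D := D)
  have hV := decomposition_total hD
  have hgraph : (diagOp (decomposition D) (eigenvalueOf D s)).graph =
      diagGraph (decomposition D) (eigenvalueOf D s) := diagOp_graph hV
  have heig : ∀ c, eigenspaceOf (diagOp (decomposition D) (eigenvalueOf D s)) c =
      (⨆ i : {i // (eigenvalueOf D s i : ℂ) = c}, decomposition D i.1).topologicalClosure := by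
    intro c
    rw [eigenspaceOf, hgraph]
    exact diagGraph_eigenspace hO hV c
  have hle : ∀ i, decomposition D i ≤
      eigenspaceOf (diagOp (decomposition D) (eigenvalueOf D s)) (eigenvalueOf D s i : ℂ) := by
    intro i
    rw [heig]
    exact (le_iSup (fun j : {j // (eigenvalueOf D s j : ℂ) = eigenvalueOf D s i} =>
      decomposition D j.1) ⟨i, rfl⟩).trans (Submodule.le_topologicalClosure _)
  have hne : ∀ η : FinPath D, (pathEigenvalue D s η : ℂ) ≠ 0 := fun η =>
    Complex.ofReal_ne_zero.2 (pathEigenvalue_neg hD s η).ne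
  have hzero : eigenspaceOf (diagOp (decomposition D) (eigenvalueOf D s)) 0 = constSpace D := by
    have e : (⨆ i : {i // (eigenvalueOf D s i : ℂ) = 0}, decomposition D i.1) = constSpace D := by
      apply le_antisymm
      · refine iSup_le ?_
        rintro ⟨_ | η, h⟩
        · exact le_rfl
        · exact absurd h (hne η)
      · exact le_iSup (fun i : {i // (eigenvalueOf D s i : ℂ) = 0} => decomposition D i.1)
          ⟨none, by simp [eigenvalueOf]⟩
    -- All `λ_η` are negative, so only the constants belong to `0`; finite dimension removes the
    -- closure.
    have : FiniteDimensional ℂ (constSpace D) := by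
      rw [constSpace_eq]; infer_instance
    rw [heig, e]
    exact (Submodule.closed_of_finiteDimensional _).submodule_topologicalClosure_eq
  have hnz : ∀ c : ℂ, c ≠ 0 →
      eigenspaceOf (diagOp (decomposition D) (eigenvalueOf D s)) c =
        (⨆ η : {η : FinPath D // (pathEigenvalue D s η : ℂ) = c},
          pathEigenspace η.1).topologicalClosure := by
    intro c hc
    rw [heig]
    congr 1
    apply le_antisymm
    · refine iSup_le ?_
      rintro ⟨_ | η, h⟩
      · exact absurd (by simpa [eigenvalueOf] using h.symm) hc
      · exact le_iSup (fun η : {η : FinPath D // (pathEigenvalue D s η : ℂ) = c} =>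
          pathEigenspace η.1) ⟨η, h⟩
    · refine iSup_le ?_
      rintro ⟨η, h⟩
      exact le_iSup (fun i : {i // (eigenvalueOf D s i : ℂ) = c} => decomposition D i.1)
        ⟨some η, h⟩
  refine ⟨isDixmierMeasure_muD hD, diagOp (decomposition D) (eigenvalueOf D s), ?_,
    diagOp_isSelfAdjoint hO hV, ?_, hzero, pathEigenvalue_nil hD s,
    fun η => ⟨pathEigenspace_ne_bot hD η, hle (some η)⟩, hnz, ?_, ?_⟩
  · intro g h
    rw [hgraph]
    exact laplaceRel_iff hD s g h
  · intro c
    constructor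
    · intro h
      by_contra! hc
      refine h ?_
      rw [hnz c hc.1]
      -- No index has this eigenvalue, so the closed span is the closure of an empty supremum.
      have : IsEmpty {η : FinPath D // (pathEigenvalue D s η : ℂ) = c} :=
        ⟨fun η => hc.2 η.1 η.2.symm⟩
      rw [iSup_of_empty]
      exact (Submodule.closed_of_finiteDimensional _).submodule_topologicalClosure_eq
    · rintro (rfl | ⟨η, rfl⟩) h
      · rw [hzero, constSpace_eq, Submodule.span_singleton_eq_bot] at h
        have h1 := inner_chiL2_chiL2 ([] : FinPath D) []
        rw [h, inner_zero_left, Set.inter_self, muD_cyl] at h1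
        exact (wD_pos ([] : FinPath D)).ne (Complex.ofReal_injective h1)
      · exact pathEigenspace_ne_bot hD η (eq_bot_iff.2 (h ▸ hle (some η)))
  · exact OrthogonalFamily.of_pairwise fun i j hij => decomposition_ortho hij
  · rw [Submodule.topologicalClosure_eq_top_iff, Submodule.eq_bot_iff]
    intro x hx
    exact hV x fun i v hv =>
      (Submodule.mem_orthogonal _ _).1 hx v (Submodule.mem_iSup_of_mem i hv)
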